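/- **Conventions.** A vector is $s$-sparse if it has at most $s$ non-zero entries. For $A\in\mathbb{R}^{m\times n}$ and $I\subseteq[m]=\{1,\dots,m\}$, $A_I$ is the submatrix of the rows of $A$ with index in $I$. A matrix $D\in\mathbb{R}^{n\times N}$ is a frame if there are $a,b>0$ with $a\|x\|_2^2\le\|D^{T}x\|_2^2\le b\|x\|_2^2$ for all $x\in\mathbb{R}^n$, and a tight frame with bound $a>0$ if $\|D^{T}x\|_2^2=a\|x\|_2^2$ for all $x\in\mathbb{R}^n$. $A$ satisfies the S-DRIP of order $s$ (for $D$) with constants $\theta_-,\theta_+$ if $$\theta_-\|Dv\|_2^2\le\min_{I\subseteq[m],\,|I|\ge m/2}\|A_IDv\|_2^2\le\max_{I\subseteq[m],\,|I|\ge m/2}\|A_IDv\|_2^2\le\theta_+\|Dv\|_2^2$$ for all $s$-sparse $v\in\mathbb{R}^N$. A Gaussian random matrix $A\in\mathbb{R}^{m\times n}$ has independent $N(0,1/m)$ entries. Write $\sigma_k(y)_1=\min\{\|y-z\|_1 : z \text{ is } k\text{-sparse}\}$, and for $t>1$ and $\delta<\sqrt{(t-1)/t}$ put $$c_1(t,\delta)=\frac{\sqrt{2(1+\delta)}}{1-\sqrt{t/(t-1)}\,\delta},\qquad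 c_2(t,\delta)=\frac{\sqrt2\,\delta+\sqrt{t(\sqrt{(t-1)/t}-\delta)\delta}}{t(\sqrt{(t-1)/t}-\delta)}+1 .$$ **Statement.** There are absolute constants $0<\theta_-<\theta_+<2$ and $c,C>0$ such that the following holds for all positive integers $k\le N$ and all $m,n$, where $A\in\mathbb{R}^{m\times n}$ is a Gaussian random matrix. 1. (S-DRIP) If $D\in\mathbb{R}^{n\times N}$ is a frame, $t\ge1$ is real and $m\ge C\,tk\log(eN/k)$, then with probability at least $1-e^{-cm}$ the matrix $A$ satisfies the S-DRIP of order $\lceil tk\rceil$ with constants $\theta_-,\theta_+$. 2. (Stable recovery) Let $D\in\mathbb{R}^{n\times N}$ be a tight frame with bound $a$, let $t$ be an integer with $t>\max\{\frac1{2\theta_--\theta_-^2},\frac1{2\theta_+-\theta_+^2}\}$, let $\delta=\max\{1-\theta_-,\theta_+-1\}$, and let $m\ge C\,tk\log(eN/k)$. Then with probability at least $1-e^{-cm}$ the following holds for all $x_0=Dz_0$ with $z_0$ $k$-sparse, all $\varepsilon\ge0$ and every solution $\hat x$ of $$\min_{x\in\mathbb{R}^n}\|D^{T}x\|_1\quad\text{subject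 to}\quad\big\||Ax|-|Ax_0|\big\|_2^2\le\varepsilon^2:$$ $$\min\{\|\hat x-x_0\|_2,\|\hat x+x_0\|_2\}\le c_1(t,\delta)\,\varepsilon+\frac{c_2(t,\delta)}{\sqrt a}\cdot\frac{2\sigma_k(D^{T}x_0)_1}{\sqrt k}.$$ 3. (Bounded redundancy) For every $\beta\ge1$ there is $C'>0$, depending only on $\beta$, such that 1 and 2 hold with the same $\theta_-,\theta_+,c$ whenever $N\le\beta n$ and $2k\le n$, with the condition on $m$ replaced by $m\ge C'\,tk\log(n/k)$. As $\theta_\pm$ are absolute and $t$ in 2 may be fixed in terms of them, this is stable phaseless recovery from $O(k\log(N/k))$ Gaussian measurements, and from $O(k\log(n/k))$ measurements for dictionaries of bounded redundancy $N/n$. -/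

import Mathlib

open MeasureTheory ProbabilityTheory
open scoped Matrix NNReal ENNReal

noncomputable section

namespace PhaselessDictionary

/-- The Euclidean norm of a finite real vector. -/
def l2norm {ι : Type*} [Fintype ι] (x : ι → ℝ) : ℝ := ‖WithLp.toLp 2 x‖

/-- The `ℓ₁` norm of a finite real vector. -/
def l1norm {ι : Type*} [Fintype ι] (x : ι → ℝ) : ℝ := ∑ i, |x i|

/-- `x` is `s`-sparse: it has at most `s` non-zero entries. -/
def IsSparse {N : ℕ} (s : ℕ) (x : Fin N → ℝ) : Prop :=
  (Finset.univ.filter fun i => x i ≠ 0).card ≤ s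

/-- The best `k`-term approximation error `min {‖y - z‖₁ : z is k-sparse}`. -/
def bestApproxError {N : ℕ} (k : ℕ) (y : Fin N → ℝ) : ℝ :=
  sInf ((fun z => l1norm (y - z)) '' {z : Fin N → ℝ | IsSparse k z})

/-- The columns of `D` form a frame of `ℝⁿ`. -/
def IsFrame {n N : ℕ} (D : Matrix (Fin n) (Fin N) ℝ) : Prop :=
  ∃ a b : ℝ, 0 < a ∧ 0 < b ∧ ∀ x : Fin n → ℝ,
    a * l2norm x ^ 2 ≤ l2norm (Dᵀ *ᵥ x) ^ 2 ∧ l2norm (Dᵀ *ᵥ x) ^ 2 ≤ b * l2norm x ^ 2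

/-- The columns of `D` form a tight frame of `ℝⁿ` with frame bound `a`. -/
def IsTightFrame {n N : ℕ} (D : Matrix (Fin n) (Fin N) ℝ) (a : ℝ) : Prop :=
  0 < a ∧ ∀ x : Fin n → ℝ, l2norm (Dᵀ *ᵥ x) ^ 2 = a * l2norm x ^ 2

/-- The submatrix `A_I` of the rows of `A` with index in `I`. -/
def rowRestrict {m n : ℕ} (A : Matrix (Fin m) (Fin n) ℝ) (I : Finset (Fin m)) :
    Matrix I (Fin n) ℝ :=
  A.submatrix (fun i : I => (i : Fin m)) id

/-- `A` has the S-DRIP of order `s` for the dictionary `D` with constants `θm`, `θp`: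
for every `s`-sparse `v`, the minimum and the maximum of `‖A_I D v‖₂²` over all sets `I` of at
least `m / 2` rows lie between `θm ‖D v‖₂²` and `θp ‖D v‖₂²`. -/
def SDRIP {m n N : ℕ} (A : Matrix (Fin m) (Fin n) ℝ) (D : Matrix (Fin n) (Fin N) ℝ)
    (s : ℕ) (θm θp : ℝ) : Prop :=
  ∀ v : Fin N → ℝ, IsSparse s v → ∀ I : Finset (Fin m), (m : ℝ) / 2 ≤ (I.card : ℝ) →
    θm * l2norm (D *ᵥ v) ^ 2 ≤ l2norm (rowRestrict A I *ᵥ (D *ᵥ v)) ^ 2 ∧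
      l2norm (rowRestrict A I *ᵥ (D *ᵥ v)) ^ 2 ≤ θp * l2norm (D *ᵥ v) ^ 2

/-- The law of the `m × n` Gaussian random matrix: independent `N(0, 1/m)` entries. -/
def gaussianMatrixLaw (m n : ℕ) : Measure (Fin m → Fin n → ℝ) :=
  Measure.pi fun _ => Measure.pi fun _ => gaussianReal 0 ((1 : ℝ≥0) / (m : ℝ≥0))

/-- The vectors `x` with `‖ |A x| - |A x₀| ‖₂² ≤ ε²`. -/
def feasibleSet {m n : ℕ} (A : Matrix (Fin m) (Fin n) ℝ) (x₀ : Fin n → ℝ) (ε : ℝ) :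
    Set (Fin n → ℝ) :=
  {x | l2norm (fun j => |(A *ᵥ x) j| - |(A *ᵥ x₀) j|) ^ 2 ≤ ε ^ 2}

/-- `xhat` solves `min ‖Dᵀ x‖₁` subject to `‖ |A x| - |A x₀| ‖₂² ≤ ε²`. -/
def IsL1AnalysisSolution {m n N : ℕ} (A : Matrix (Fin m) (Fin n) ℝ)
    (D : Matrix (Fin n) (Fin N) ℝ) (x₀ : Fin n → ℝ) (ε : ℝ) (xhat : Fin n → ℝ) : Prop :=
  xhat ∈ feasibleSet A x₀ ε ∧ ∀ x ∈ feasibleSet A x₀ ε, l1norm (Dᵀ *ᵥ xhat) ≤ l1norm (Dᵀ *ᵥ x)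

/-- Stable phaseless recovery, up to a global sign, of every signal `x₀ = D z₀` with `z₀`
`k`-sparse, at every noise level `ε ≥ 0`, by every solution of the `ℓ₁`-analysis model. -/
def StableRecovery {m n N : ℕ} (A : Matrix (Fin m) (Fin n) ℝ) (D : Matrix (Fin n) (Fin N) ℝ)
    (k : ℕ) (c₁ c₂ : ℝ) : Prop :=
  ∀ x₀ : Fin n → ℝ, (∃ z₀ : Fin N → ℝ, IsSparse k z₀ ∧ x₀ = D *ᵥ z₀) →
    ∀ ε : ℝ, 0 ≤ ε → ∀ xhat : Fin n → ℝ, IsL1AnalysisSolution A D x₀ ε xhat →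
      min (l2norm (xhat - x₀)) (l2norm (xhat + x₀)) ≤
        c₁ * ε + c₂ * (2 * bestApproxError k (Dᵀ *ᵥ x₀) / √(k : ℝ))

/-- The noise constant `√(2(1+δ)) / (1 - √(t/(t-1)) δ)`. -/
def noiseConst (t δ : ℝ) : ℝ := √(2 * (1 + δ)) / (1 - √(t / (t - 1)) * δ)

/-- The constant
`(√2 δ + √(t (√((t-1)/t) - δ) δ)) / (t (√((t-1)/t) - δ)) + 1` of the approximation error. -/
def approxConst (t δ : ℝ) : ℝ :=
  (√2 * δ + √(t * (√((t - 1) / t) - δ) * δ)) / (t * (√((t - 1) / t) - δ)) + 1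

end PhaselessDictionary

end

open PhaselessDictionary

/-! Phaseless recovery reduces to linear recovery by pigeonhole. Split the rows according to whether
the measurements of a minimizer `xhat` and of `x₀` agree in sign. One class `I` has at least half of
the rows, and on it the phaseless residual is, up to signs, `A_I (xhat - x₀)` or `A_I (xhat + x₀)`.
The S-DRIP makes every such `A_I` a restricted isometry on `D`-images of sparse vectors, with `δ =
max (1 - θm) (θp - 1)`; see `SDRIP.stableRecovery`.

The linear problem (`norm_le_of_restricted_isometry`) is solved by the sharp Cai-Zhang argument.
After rescaling, `D Dᵀ = 1`. The coefficients `h = Dᵀ y` of the error `y` split into a sparse part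
`b` of large entries and a part `v` that is small in both `ℓ∞` and `ℓ₁`. Such a `v` lies in the
closed convex hull of sparse vectors (`linear_le_of_sparse_le`), so an estimate linear in `v` need
only be tested on sparse vectors, where the restricted isometry applies. It yields a quadratic
inequality for `‖b‖₂`, solvable when `δ < √((t - 1) / t)`, that is, when `t > 1 / (1 - δ²)`.

For the S-DRIP, fix a unit vector: its products with the rows are independent `N(0, 1/m)`. A
Chernoff bound controls the total energy from above. With a tiny threshold, the energy of a given
half of the rows is too small with probability at most `(e / 10) ^ m`, which survives the union over
all `2 ^ m` sets of rows. A net of the span of each choice of columns, and a union over the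
supports, whose number is at most `exp (s log (e N / k))`, conclude. -/

namespace PhaselessDictionary

/-! ### Sparse vectors as extreme points -/

section Sparse

variable {N : ℕ}

/-- An extreme point of a box intersected with a half space `∑ w ≤ s α` is `s`-sparse. -/
lemma isSparse_of_mem_extremePoints {s : ℕ} {α : ℝ} {c : Fin N → ℝ} (hc : ∀ i, c i = 0 ∨ c i = α)
    {w : Fin N → ℝ}
    (hw : w ∈ Set.extremePoints ℝ {w : Fin N → ℝ | (∀ i, 0 ≤ w i ∧ w i ≤ c i) ∧ ∑ i, w i ≤ s * α}) :
    IsSparse s w := by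
  classical
  obtain ⟨⟨hb, hs⟩, hext⟩ := hw
  -- At most one coordinate is strictly between its bounds: with two of them, mass could be moved
  -- from one to the other in either direction without changing the sum.
  have key : ∀ i j, i ≠ j → 0 < w i → w i < c i → 0 < w j → ¬ w j < c j := by
    intro i j hij h1 h2 h3 h4
    obtain ⟨τ, hτ, hτ1, hτ2, hτ3, hτ4⟩ : ∃ τ : ℝ, 0 < τ ∧ τ ≤ w i ∧ τ ≤ c i - w i ∧ τ ≤ w j ∧
        τ ≤ c j - w j :=
      ⟨min (min (w i) (c i - w i)) (min (w j) (c j - w j)), by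
        simp [h1, h2, h3, h4], by simp, by simp, by simp, by simp⟩
    set d : Fin N → ℝ := Pi.single i τ - Pi.single j τ with hd
    have hdi : d i = τ := by simp [hd, hij]
    have hdj : d j = -τ := by simp [hd, hij.symm]
    have hdl : ∀ l, l ≠ i → l ≠ j → d l = 0 := by
      intro l h1 h2; simp [hd, h1, h2]
    have hdsum : ∑ l, d l = 0 := by simp [hd, Finset.sum_sub_distrib]
    have hmem : ∀ e : ℝ, |e| ≤ 1 → w + e • d ∈
        {w : Fin N → ℝ | (∀ i, 0 ≤ w i ∧ w i ≤ c i) ∧ ∑ i, w i ≤ s * α} := by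
      intro e he
      rw [abs_le] at he
      refine ⟨fun l => ?_, ?_⟩
      · simp only [Pi.add_apply, Pi.smul_apply, smul_eq_mul]
        by_cases hli : l = i
        · subst hli; rw [hdi]; constructor <;> nlinarith
        by_cases hlj : l = j
        · subst hlj; rw [hdj]; constructor <;> nlinarith
        · rw [hdl l hli hlj]; simpa using hb l
      · simpa [Finset.sum_add_distrib, ← Finset.mul_sum, hdsum] using hs
    have := hext (hmem 1 (by simp)) (hmem (-1) (by simp)) ⟨1 / 2, 1 / 2, by norm_num, by norm_num,
      by norm_num, by ext l; simp; ring⟩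
    have h := congrFun this i
    simp [hdi] at h
    exact hτ.ne' h
  by_contra hcon
  simp only [IsSparse, not_le] at hcon
  set S := Finset.univ.filter fun i => w i ≠ 0 with hS
  have hpos : ∀ i ∈ S, 0 < w i := fun i hi =>
    lt_of_le_of_ne (hb i).1 (Ne.symm (by simpa [hS] using hi))
  -- All non-zero coordinates but one are saturated. With `s + 1` of them, the `s` saturated ones
  -- already use up `s α`, and the last one exceeds the budget.
  obtain ⟨i₀, hi₀, hsat⟩ : ∃ i₀ ∈ S, ∀ j ∈ S, j ≠ i₀ → α ≤ w j := by
    by_cases hF : ∃ i ∈ S, w i < c i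
    · obtain ⟨i, hi, hic⟩ := hF
      refine ⟨i, hi, fun j hj hji => ?_⟩
      have := key i j hji.symm (hpos i hi) hic (hpos j hj)
      rcases hc j with h | h
      · have := (hb j).2; have := hpos j hj; linarith
      · linarith
    · push Not at hF
      obtain ⟨i, hi⟩ : S.Nonempty := Finset.card_pos.1 (by omega)
      refine ⟨i, hi, fun j hj _ => ?_⟩
      have := hF j hj
      rcases hc j with h | h
      · have := (hb j).2; have := hpos j hj; linarith
      · linarith
  have h0 := hpos i₀ hi₀
  have hα : 0 ≤ α := by
    rcases hc i₀ with h | h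
    · have := (hb i₀).2; linarith
    · have := (hb i₀).2; linarith
  have h1 : ∑ i ∈ S, w i ≤ ∑ i, w i :=
    Finset.sum_le_sum_of_subset_of_nonneg (Finset.subset_univ _) fun i _ _ => (hb i).1
  rw [← Finset.add_sum_erase _ _ hi₀] at h1
  have h2 : ((S.erase i₀).card : ℝ) * α ≤ ∑ i ∈ S.erase i₀, w i := by
    rw [← nsmul_eq_mul]
    refine Finset.card_nsmul_le_sum _ _ _ fun j hj => ?_
    exact hsat j (Finset.mem_of_mem_erase hj) (Finset.ne_of_mem_erase hj)
  have h3 : s ≤ (S.erase i₀).card := by rw [Finset.card_erase_of_mem hi₀]; omega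
  have h4 : (s : ℝ) * α ≤ ((S.erase i₀).card : ℝ) * α := by gcongr
  linarith

/-- A linear functional bounded by `C` on the `s`-sparse vectors with entries at most `α` is
bounded by `C` on the intersection of the `ℓ∞`-ball of radius `α` and the `ℓ₁`-ball of radius
`s α`. -/
lemma linear_le_of_sparse_le {s : ℕ} {α : ℝ} {v : Fin N → ℝ} (hv : ∀ i, |v i| ≤ α)
    (hv1 : ∑ i, |v i| ≤ s * α) (φ : (Fin N → ℝ) →ₗ[ℝ] ℝ) (C : ℝ)
    (hφ : ∀ u : Fin N → ℝ, IsSparse s u → (∀ i, v i = 0 → u i = 0) → (∀ i, |u i| ≤ α) → φ u ≤ C) :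
    φ v ≤ C := by
  classical
  set c : Fin N → ℝ := fun i => if v i = 0 then 0 else α with hc
  set K : Set (Fin N → ℝ) := {w | (∀ i, 0 ≤ w i ∧ w i ≤ c i) ∧ ∑ i, w i ≤ s * α} with hK
  have hKeq : K = Set.Icc 0 c ∩ {w | ∑ i, w i ≤ s * α} := by
    ext w; simp [hK, Pi.le_def, forall_and]
  have hcomp : IsCompact K := by
    rw [hKeq]
    exact isCompact_Icc.inter_right (isClosed_le (by fun_prop) continuous_const)
  have hconv : Convex ℝ K := by
    rw [hKeq]
    refine (convex_Icc _ _).inter ?_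
    exact convex_halfSpace_le (f := fun w : Fin N → ℝ => ∑ i, w i)
      ⟨fun x y => by simp [Finset.sum_add_distrib], fun a x => by simp [Finset.mul_sum]⟩ _
  -- Restoring the signs of `v` allows working with absolute values in the non-negative orthant;
  -- Krein-Milman then applies to the compact convex set `K`.
  let ψ : (Fin N → ℝ) →ₗ[ℝ] ℝ :=
    φ ∘ₗ LinearMap.pi fun i => (SignType.sign (v i) : ℝ) • LinearMap.proj i
  have hψ : ∀ w, ψ w = φ (fun i => (SignType.sign (v i) : ℝ) * w i) := fun w => rfl
  have hψc : Continuous ψ := ψ.continuous_of_finiteDimensional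
  have hsub : K ⊆ {w | ψ w ≤ C} := by
    rw [← closure_convexHull_extremePoints hcomp hconv]
    refine closure_minimal (convexHull_min ?_ (convex_halfSpace_le ψ.isLinear _))
      (isClosed_le hψc continuous_const)
    intro w hw
    have hsp := isSparse_of_mem_extremePoints (c := c)
      (fun i => by by_cases h : v i = 0 <;> simp [hc, h]) hw
    have hb := hw.1.1
    refine hφ _ ?_ ?_ ?_
    · refine le_trans (Finset.card_le_card fun i => ?_) hsp
      simp only [Finset.mem_filter, Finset.mem_univ, true_and]
      intro h h'
      exact h (by simp [h'])
    · intro i hi; simp [hi]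
    · intro i
      have h1 := hb i
      by_cases hvi : v i = 0
      · simpa [hvi] using (abs_nonneg _).trans (hv i)
      · simp only [hc, hvi, if_false] at h1
        change |(SignType.sign (v i) : ℝ) * w i| ≤ α
        rw [abs_mul, abs_of_nonneg h1.1]
        have : |(SignType.sign (v i) : ℝ)| = 1 := by
          rcases lt_or_gt_of_ne hvi with h | h <;> simp [h]
        rw [this, one_mul]; exact h1.2
  have hmem : (fun i => |v i|) ∈ K := by
    refine ⟨fun i => ⟨abs_nonneg _, ?_⟩, hv1⟩
    by_cases h : v i = 0
    · simp [hc, h]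
    · simpa [hc, h] using hv i
  have := hsub hmem
  simpa [hψ, sign_mul_abs] using this

end Sparse

/-! ### Largest entries and the cone condition -/

section Cone

variable {N : ℕ}

/-- There is a set of the `k` largest entries of `w`. -/
lemma exists_top_entries (w : Fin N → ℝ) {k : ℕ} (hk : k ≤ N) :
    ∃ H : Finset (Fin N), H.card = k ∧ (∀ i ∈ H, ∀ j ∉ H, |w j| ≤ |w i|) ∧
      ∀ S : Finset (Fin N), S.card ≤ k → ∑ i ∈ S, |w i| ≤ ∑ i ∈ H, |w i| := by
  classical
  obtain ⟨H, hH, hmax⟩ := Finset.exists_max_image (Finset.powersetCard k Finset.univ)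
    (fun S : Finset (Fin N) => ∑ i ∈ S, |w i|)
    (Finset.powersetCard_nonempty.2 (by simpa using hk))
  rw [Finset.mem_powersetCard_univ] at hH
  refine ⟨H, hH, fun i hi j hj => ?_, fun S hS => ?_⟩
  · have hj' : j ∉ H.erase i := fun h => hj (Finset.mem_of_mem_erase h)
    have hpos : 0 < H.card := Finset.card_pos.2 ⟨i, hi⟩
    have := hmax (insert j (H.erase i)) (by
      rw [Finset.mem_powersetCard_univ, Finset.card_insert_of_notMem hj',
        Finset.card_erase_of_mem hi]
      omega)
    rw [Finset.sum_insert hj', ← Finset.add_sum_erase H _ hi] at this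
    linarith
  · obtain ⟨S', hS', hc⟩ := Finset.exists_superset_card_eq hS (by simpa using hk)
    exact (Finset.sum_le_sum_of_subset_of_nonneg hS' fun i _ _ => abs_nonneg _).trans
      (hmax S' (by rw [Finset.mem_powersetCard_univ, hc]))

/-- The cone condition for an `ℓ₁`-minimizer, on a set of the `k` largest entries. -/
lemma sum_compl_le_of_l1norm_add_le {x w : Fin N → ℝ} (h : l1norm (x + w) ≤ l1norm x) {k : ℕ}
    {H : Finset (Fin N)}
    (hH : ∀ S : Finset (Fin N), S.card ≤ k → ∑ i ∈ S, |w i| ≤ ∑ i ∈ H, |w i|) :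
    ∑ i ∈ Hᶜ, |w i| ≤ ∑ i ∈ H, |w i| + 2 * bestApproxError k x := by
  classical
  suffices hz : ∀ z : Fin N → ℝ, IsSparse k z →
      (∑ i ∈ Hᶜ, |w i| - ∑ i ∈ H, |w i|) / 2 ≤ l1norm (x - z) by
    have : (∑ i ∈ Hᶜ, |w i| - ∑ i ∈ H, |w i|) / 2 ≤ bestApproxError k x := by
      refine le_csInf ⟨_, 0, by simp [IsSparse], rfl⟩ ?_
      rintro _ ⟨z, hz', rfl⟩
      exact hz z hz'
    linarith
  -- With `S` the support of `z`, minimality gives `‖w_Sᶜ‖₁ - ‖w_S‖₁ ≤ 2 ‖x_Sᶜ‖₁ ≤ 2 ‖x - z‖₁`, and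
  -- replacing `S` by `H` only decreases the left side.
  intro z hz
  set S := Finset.univ.filter fun i => z i ≠ 0 with hS
  have h1 := hH S hz
  have hsplit : ∀ (T : Finset (Fin N)) (f : Fin N → ℝ), ∑ i, f i = ∑ i ∈ T, f i + ∑ i ∈ Tᶜ, f i :=
    fun T f => (Finset.sum_add_sum_compl T f).symm
  have e1 := hsplit H fun i => |w i|
  have e2 := hsplit S fun i => |w i|
  have e3 := hsplit S fun i => |x i|
  have e4 := hsplit S fun i => |(x + w) i|
  have e5 := hsplit S fun i => |(x - z) i|
  have i1 : ∑ i ∈ S, |x i| - ∑ i ∈ S, |w i| ≤ ∑ i ∈ S, |(x + w) i| := by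
    rw [← Finset.sum_sub_distrib]
    refine Finset.sum_le_sum fun i _ => ?_
    have := abs_sub_abs_le_abs_sub (x i) (-(w i))
    simpa using this
  have i2 : ∑ i ∈ Sᶜ, |w i| - ∑ i ∈ Sᶜ, |x i| ≤ ∑ i ∈ Sᶜ, |(x + w) i| := by
    rw [← Finset.sum_sub_distrib]
    refine Finset.sum_le_sum fun i _ => ?_
    have := abs_sub_abs_le_abs_sub (w i) (-(x i))
    simpa [add_comm] using this
  have i3 : ∑ i ∈ Sᶜ, |x i| = ∑ i ∈ Sᶜ, |(x - z) i| := by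
    refine Finset.sum_congr rfl fun i hi => ?_
    have : z i = 0 := by simpa [hS] using hi
    simp [this]
  have i4 : 0 ≤ ∑ i ∈ S, |(x - z) i| := Finset.sum_nonneg fun i _ => abs_nonneg _
  simp only [l1norm] at h ⊢
  linarith

end Cone

/-! ### The quadratic inequality from the restricted isometry property -/

section RestrictedIsometry

variable {N : ℕ} {F G : Type*} [NormedAddCommGroup F] [InnerProductSpace ℝ F]
  [NormedAddCommGroup G] [InnerProductSpace ℝ G]

lemma IsSparse.smul_add_smul {i j l : ℕ} {b u : Fin N → ℝ} (hb : IsSparse i b) (hu : IsSparse j u)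
    (hl : i + j ≤ l) (x y : ℝ) : IsSparse l (x • b + y • u) := by
  classical
  refine le_trans (le_trans (Finset.card_le_card (t := (Finset.univ.filter fun i => b i ≠ 0) ∪
    Finset.univ.filter fun i => u i ≠ 0) fun a => ?_) (Finset.card_union_le _ _))
    ((add_le_add hb hu).trans hl)
  simp only [Finset.mem_filter, Finset.mem_univ, true_and, Finset.mem_union, Pi.add_apply,
    Pi.smul_apply, smul_eq_mul]
  intro h
  by_contra hcon
  push Not at hcon
  exact h (by simp [hcon.1, hcon.2])

lemma dotProduct_self_le_of_isSparse {s : ℕ} {κ : ℝ} {u : Fin N → ℝ} (hu : IsSparse s u)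
    (hκ : ∀ i, |u i| ≤ κ) : u ⬝ᵥ u ≤ s * κ ^ 2 := by
  have h1 : u ⬝ᵥ u = ∑ i ∈ Finset.univ.filter fun i => u i ≠ 0, u i ^ 2 := by
    rw [dotProduct, Finset.sum_filter]
    refine Finset.sum_congr rfl fun i _ => ?_
    by_cases h : u i = 0
    · simp [h]
    · simp [h, sq]
  rw [h1]
  calc _ ≤ ((Finset.univ.filter fun i => u i ≠ 0).card : ℝ) * κ ^ 2 := by
        rw [← nsmul_eq_mul]
        refine Finset.sum_le_card_nsmul _ _ _ fun i _ => ?_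
        rw [← sq_abs]
        exact pow_le_pow_left₀ (abs_nonneg _) (hκ i) 2
    _ ≤ s * κ ^ 2 := by
        have : ((Finset.univ.filter fun i => u i ≠ 0).card : ℝ) ≤ s := by exact_mod_cast hu
        gcongr

/-- The weights are chosen so that the terms `‖Al u‖²` cancel, which leaves an expression affine in
`u`. Once `p + u` is the full error `y`, the right side involves only `⟪Al p, Al y⟫`, which is
controlled by the noise. -/
lemma norm_map_sub_sq_sub_norm_map_add_sq (Al : F →ₗ[ℝ] G) (p u : F) (μ : ℝ) :
    ‖Al ((1 / 2 - μ) • p + (-(μ / 2)) • u)‖ ^ 2 - 1 / 4 * ‖Al ((1 : ℝ) • p + μ • u)‖ ^ 2 =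
      -(μ * (1 - μ)) * (‖Al p‖ ^ 2 + inner ℝ (Al p) (Al u)) := by
  simp only [map_add, map_smul, norm_add_sq_real, norm_smul, inner_smul_left, inner_smul_right,
    mul_pow, Real.norm_eq_abs, sq_abs]
  simp
  ring

/-- The quadratic inequality behind the restricted isometry bound, for a splitting `b + v` into a
sparse part `b` and a part `v` with small entries. -/
lemma restricted_isometry_quadratic {Dl : (Fin N → ℝ) →ₗ[ℝ] F} {Al : F →ₗ[ℝ] G}
    {b v : Fin N → ℝ} {y : F} (hy : Dl (b + v) = y) {X : ℝ} (hX0 : 0 ≤ X)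
    (hX : X ^ 2 = inner ℝ (Dl b) y) (hbX : ‖Dl b‖ ≤ X)
    (hcontr : ∀ u, ‖Dl u‖ ^ 2 ≤ u ⬝ᵥ u) {j s l : ℕ} (hjs : j + s ≤ l) (hb : IsSparse j b)
    {κ : ℝ} (hv : ∀ i, |v i| ≤ κ) (hv1 : ∑ i, |v i| ≤ s * κ) {δ μ ε : ℝ} (hδ : 0 ≤ δ)
    (hμ0 : 0 ≤ μ) (hμ : μ ≤ 1 / 2)
    (hR : ∀ u, IsSparse l u → (1 - δ) * ‖Dl u‖ ^ 2 ≤ ‖Al (Dl u)‖ ^ 2 ∧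
      ‖Al (Dl u)‖ ^ 2 ≤ (1 + δ) * ‖Dl u‖ ^ 2)
    (hε : ‖Al y‖ ≤ ε) :
    0 ≤ (δ * (1 / 2 - μ + μ ^ 2) - μ * (1 - μ)) * X ^ 2 + μ * (1 - μ) * (√(1 + δ) * X * ε) +
      δ * μ ^ 2 / 2 * (s * κ ^ 2) := by
  set p := Dl b with hp
  -- The part linear in `u` of the upper isometry bound for `(1/2 - μ) p - (μ/2) u` combined with
  -- the lower one for `p + μ u`. The remaining quadratic term `δ μ² ‖Dl u‖² / 2` is bounded by the
  -- sparsity of `u`.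
  let φ : (Fin N → ℝ) →ₗ[ℝ] ℝ :=
    (-(μ * (1 - μ))) • ((innerₛₗ ℝ (Al p)) ∘ₗ Al ∘ₗ Dl) +
      (μ * (1 - μ - δ * μ)) • ((innerₛₗ ℝ p) ∘ₗ Dl)
  have hφ : ∀ u, φ u = -(μ * (1 - μ)) * inner ℝ (Al p) (Al (Dl u)) +
      μ * (1 - μ - δ * μ) * inner ℝ p (Dl u) := fun u => by simp [φ]
  have hlin := linear_le_of_sparse_le hv hv1 φ (μ * (1 - μ) * ‖Al p‖ ^ 2 +
    ((1 + δ) * (1 / 2 - μ) ^ 2 - (1 - δ) / 4) * ‖p‖ ^ 2 + δ * μ ^ 2 / 2 * (s * κ ^ 2)) (by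
    intro u hu _ hκ
    have h1 := (hR _ (hb.smul_add_smul hu hjs (1 / 2 - μ) (-(μ / 2)))).2
    have h2 := (hR _ (hb.smul_add_smul hu hjs 1 μ)).1
    have h3 := norm_map_sub_sq_sub_norm_map_add_sq Al p (Dl u) μ
    rw [map_add, map_smul, map_smul, ← hp] at h1 h2
    have e1 : ‖(1 / 2 - μ) • p + (-(μ / 2)) • Dl u‖ ^ 2 = (1 / 2 - μ) ^ 2 * ‖p‖ ^ 2 -
        (1 / 2 - μ) * μ * inner ℝ p (Dl u) + μ ^ 2 / 4 * ‖Dl u‖ ^ 2 := by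
      simp only [norm_add_sq_real, norm_smul, inner_smul_left, inner_smul_right,
        mul_pow, Real.norm_eq_abs, sq_abs]
      simp
      ring
    have e2 : ‖(1 : ℝ) • p + μ • Dl u‖ ^ 2 = ‖p‖ ^ 2 + 2 * μ * inner ℝ p (Dl u) +
        μ ^ 2 * ‖Dl u‖ ^ 2 := by
      simp only [norm_add_sq_real, norm_smul, inner_smul_left, inner_smul_right,
        mul_pow, Real.norm_eq_abs, sq_abs]
      simp
      ring
    rw [e1] at h1
    rw [e2] at h2
    have h4 : δ * μ ^ 2 / 2 * ‖Dl u‖ ^ 2 ≤ δ * μ ^ 2 / 2 * (s * κ ^ 2) :=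
      mul_le_mul_of_nonneg_left
        ((hcontr u).trans (dotProduct_self_le_of_isSparse hu hκ)) (by positivity)
    rw [hφ]
    linarith)
  rw [hφ] at hlin
  have hDv : Dl v = y - p := by rw [← hy, map_add]; abel
  rw [hDv, map_sub, inner_sub_right, inner_sub_right, real_inner_self_eq_norm_sq,
    real_inner_self_eq_norm_sq, ← hX] at hlin
  have hAp : ‖Al p‖ ≤ √(1 + δ) * X := by
    have h0 := (hb.smul_add_smul (u := 0) (j := s) (by simp [IsSparse]) hjs 1 0)
    simp only [one_smul, smul_zero, add_zero] at h0
    refine (Real.le_sqrt_of_sq_le (hR _ h0).2).trans ?_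
    rw [Real.sqrt_mul (by positivity), Real.sqrt_sq (norm_nonneg _)]
    gcongr
  have hcs : inner ℝ (Al p) (Al y) ≤ √(1 + δ) * X * ε := by
    have h1 := real_inner_le_norm (Al p) (Al y)
    have h2 : ‖Al p‖ * ‖Al y‖ ≤ √(1 + δ) * X * ε :=
      mul_le_mul hAp hε (norm_nonneg _) (by positivity)
    linarith
  have hcs' := mul_le_mul_of_nonneg_left hcs (mul_nonneg hμ0 (by linarith : 0 ≤ 1 - μ))
  have hpX : δ * (1 / 2 - μ) * ‖p‖ ^ 2 ≤ δ * (1 / 2 - μ) * X ^ 2 :=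
    mul_le_mul_of_nonneg_left (pow_le_pow_left₀ (norm_nonneg _) hbX 2)
      (mul_nonneg hδ (by linarith))
  linarith

lemma le_add_sqrt_of_sq_le {A B C X : ℝ} (hA : 0 < A) (hB : 0 ≤ B) (hC : 0 ≤ C)
    (h : A * X ^ 2 ≤ B * X + C) : X ≤ B / A + √(C / A) := by
  have hs := Real.sq_sqrt (div_nonneg hC hA.le)
  have hs0 := Real.sqrt_nonneg (C / A)
  have hBA : 0 ≤ B / A := by positivity
  have h' : X ^ 2 ≤ B / A * X + C / A := by
    have := div_le_div_of_nonneg_right h hA.le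
    rwa [mul_div_cancel_left₀ _ hA.ne', add_div, mul_div_right_comm] at this
  by_contra hcon
  push Not at hcon
  nlinarith

/-- The solution of the quadratic inequality, for the optimal value of the free parameter. -/
lemma le_of_restricted_isometry_quadratic {r δ ε X P : ℝ} (hr : 0 < r) (hr1 : r < 1)
    (hδ : 0 ≤ δ) (hδr : δ < r) (hε : 0 ≤ ε) (hP : 0 ≤ P) {R : ℝ}
    (hR : R ≤ (X + P) ^ 2 * ((1 - r ^ 2) / r ^ 2))
    (h : 0 ≤ (δ * (1 / 2 - r / (1 + r) + (r / (1 + r)) ^ 2) - r / (1 + r) * (1 - r / (1 + r))) *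
      X ^ 2 + r / (1 + r) * (1 - r / (1 + r)) * (√(1 + δ) * X * ε) +
      δ * (r / (1 + r)) ^ 2 / 2 * R) :
    X ≤ (r * √(1 + δ) * ε + δ * (1 - r ^ 2) * P) / (r - δ) +
      √(δ * (1 - r ^ 2) / (2 * (r - δ))) * P := by
  have h1 : δ * (r / (1 + r)) ^ 2 / 2 * R ≤
      δ * (r / (1 + r)) ^ 2 / 2 * ((X + P) ^ 2 * ((1 - r ^ 2) / r ^ 2)) := by gcongr
  have h2 := h.trans (add_le_add_right h1 _)
  -- For `μ = r / (1 + r)` the contributions `δ (1 + r²) / 2` and `δ (1 - r²) / 2` to the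
  -- coefficient of `X²` add up to `δ`; solvability becomes exactly `δ < r`.
  have e : (δ * (1 / 2 - r / (1 + r) + (r / (1 + r)) ^ 2) - r / (1 + r) * (1 - r / (1 + r))) *
      X ^ 2 + r / (1 + r) * (1 - r / (1 + r)) * (√(1 + δ) * X * ε) +
      δ * (r / (1 + r)) ^ 2 / 2 * ((X + P) ^ 2 * ((1 - r ^ 2) / r ^ 2)) =
      ((δ - r) * X ^ 2 + r * √(1 + δ) * ε * X + δ * (1 - r ^ 2) / 2 * (2 * X * P + P ^ 2)) /
        (1 + r) ^ 2 := by
    field_simp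
    ring
  rw [e] at h2
  have h3 : 0 ≤ (δ - r) * X ^ 2 + r * √(1 + δ) * ε * X +
      δ * (1 - r ^ 2) / 2 * (2 * X * P + P ^ 2) := by
    by_contra hcon
    push Not at hcon
    exact absurd h2 (not_le.2 (div_neg_of_neg_of_pos hcon (by positivity)))
  have hr2 : 0 ≤ 1 - r ^ 2 := by nlinarith
  have h4 := le_add_sqrt_of_sq_le (A := r - δ) (B := r * √(1 + δ) * ε + δ * (1 - r ^ 2) * P)
    (C := δ * (1 - r ^ 2) / 2 * P ^ 2) (X := X) (by linarith) (by positivity) (by positivity)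
    (by linarith)
  refine h4.trans (add_le_add_right (le_of_eq ?_) _)
  have : δ * (1 - r ^ 2) / 2 * P ^ 2 / (r - δ) = δ * (1 - r ^ 2) / (2 * (r - δ)) * P ^ 2 := by
    have : r - δ ≠ 0 := by linarith
    field_simp
  have hd : 0 < r - δ := by linarith
  rw [this, Real.sqrt_mul (by positivity), Real.sqrt_sq hP]

end RestrictedIsometry

/-! ### Stable recovery from the restricted isometry property -/

section Recovery

/-- The final bound is `‖y‖ ≤ √2 X + P`; inserting the bound on `X` produces the stated constants,
since `1 - r² = 1 / t`. -/
lemma sqrt_two_mul_add_eq_noiseConst_approxConst {t r δ ε P : ℝ} (ht : 1 < t)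
    (hr : r = √((t - 1) / t)) (hδ : 0 ≤ δ) (hδr : δ < r) :
    √2 * ((r * √(1 + δ) * ε + δ * (1 - r ^ 2) * P) / (r - δ) +
      √(δ * (1 - r ^ 2) / (2 * (r - δ))) * P) + P = noiseConst t δ * ε + approxConst t δ * P := by
  have ht0 : 0 < t := by linarith
  have hr2 : r ^ 2 = (t - 1) / t := by
    rw [hr, Real.sq_sqrt (div_nonneg (by linarith) ht0.le)]
  have hr0 : 0 < r := hδ.trans_lt hδr
  have hd : 0 < r - δ := by linarith
  have e1 : 1 - r ^ 2 = 1 / t := by rw [hr2]; field_simp; ring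
  have e2 : √(t / (t - 1)) = 1 / r := by
    rw [hr, one_div, ← Real.sqrt_inv, inv_div]
  have e3 : √2 * √(δ * (1 - r ^ 2) / (2 * (r - δ))) = √(t * (r - δ) * δ) / (t * (r - δ)) := by
    rw [← Real.sqrt_mul (by norm_num), e1, eq_div_iff (by positivity),
      ← Real.sqrt_sq (by positivity : 0 ≤ t * (r - δ)), ← Real.sqrt_mul (by positivity)]
    rw [Real.sqrt_sq (by positivity : 0 ≤ t * (r - δ))]
    congr 1
    field_simp
  rw [noiseConst, approxConst, e2, ← hr, Real.sqrt_mul (by norm_num)]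
  calc _ = √2 * (r * √(1 + δ) * ε + δ * (1 - r ^ 2) * P) / (r - δ) +
        √2 * √(δ * (1 - r ^ 2) / (2 * (r - δ))) * P + P := by ring
    _ = _ := by
        rw [e3, e1]
        have : 1 - 1 / r * δ = (r - δ) / r := by field_simp
        rw [this]
        field_simp
        ring

/-- The `ℓ₂`-norm of the tail, off a set of the `k` largest entries. -/
lemma sum_compl_sq_le {N k : ℕ} {h : Fin N → ℝ} {H : Finset (Fin N)} (hHk : H.card = k)
    (hk : 1 ≤ k) (htop : ∀ i ∈ H, ∀ j ∉ H, |h j| ≤ |h i|) {σ X : ℝ} (hσ : 0 ≤ σ)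
    (hcone : ∑ i ∈ Hᶜ, |h i| ≤ ∑ i ∈ H, |h i| + 2 * σ) (hX : 0 ≤ X)
    (hLX : ∑ i ∈ H, |h i| ≤ √k * X) :
    ∑ i ∈ Hᶜ, h i ^ 2 ≤ X * (X + 2 * σ / √k) := by
  have hk' : (1 : ℝ) ≤ k := by exact_mod_cast hk
  have hsk : 0 < √(k : ℝ) := Real.sqrt_pos.2 (by linarith)
  have hsk2 : √(k : ℝ) ^ 2 = k := Real.sq_sqrt (by linarith)
  set L := ∑ i ∈ H, |h i| with hL
  have hL0 : 0 ≤ L := Finset.sum_nonneg fun i _ => abs_nonneg _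
  have htail : ∀ j ∈ Hᶜ, |h j| ≤ L / k := by
    intro j hj
    rw [le_div_iff₀ (by positivity), mul_comm, ← hHk, ← nsmul_eq_mul]
    exact Finset.card_nsmul_le_sum _ _ _ fun i hi => htop i hi j (Finset.mem_compl.1 hj)
  calc ∑ i ∈ Hᶜ, h i ^ 2 ≤ ∑ i ∈ Hᶜ, L / k * |h i| := by
        refine Finset.sum_le_sum fun i hi => ?_
        rw [← sq_abs, sq]
        exact mul_le_mul_of_nonneg_right (htail i hi) (abs_nonneg _)
    _ ≤ L / k * (L + 2 * σ) := by
        rw [← Finset.mul_sum]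
        exact mul_le_mul_of_nonneg_left hcone (by positivity)
    _ = L / √k * ((L + 2 * σ) / √k) := by
        rw [div_mul_div_comm, ← sq, hsk2]; ring
    _ ≤ X * (X + 2 * σ / √k) := by
        refine mul_le_mul ?_ ?_ (by positivity) hX
        · rw [div_le_iff₀ hsk]; linarith
        · rw [add_div]
          gcongr
          rw [div_le_iff₀ hsk]; linarith

variable {N : ℕ} {F G : Type*} [NormedAddCommGroup F] [InnerProductSpace ℝ F]
  [NormedAddCommGroup G] [InnerProductSpace ℝ G]

/-- Stable recovery from the restricted isometry property of order `t k` with constant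
`δ < √((t - 1) / t)`, relative to a Parseval frame. -/
theorem norm_le_of_restricted_isometry {Dl : (Fin N → ℝ) →ₗ[ℝ] F} {Al : F →ₗ[ℝ] G}
    {h : Fin N → ℝ} {y : F} (hy : Dl h = y) (hin : ∀ u, inner ℝ (Dl u) y = u ⬝ᵥ h)
    (hcontr : ∀ u, ‖Dl u‖ ^ 2 ≤ u ⬝ᵥ u) {k t : ℕ} (hk : 1 ≤ k) (ht : 2 ≤ t) {δ σ ε : ℝ}
    (hδ : 0 ≤ δ) (hδt : δ < √(((t : ℝ) - 1) / t)) (hσ : 0 ≤ σ)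
    {H : Finset (Fin N)} (hHk : H.card = k) (htop : ∀ i ∈ H, ∀ j ∉ H, |h j| ≤ |h i|)
    (hcone : ∑ i ∈ Hᶜ, |h i| ≤ ∑ i ∈ H, |h i| + 2 * σ)
    (hR : ∀ u, IsSparse (t * k) u → (1 - δ) * ‖Dl u‖ ^ 2 ≤ ‖Al (Dl u)‖ ^ 2 ∧
      ‖Al (Dl u)‖ ^ 2 ≤ (1 + δ) * ‖Dl u‖ ^ 2)
    (hε : ‖Al y‖ ≤ ε) :
    ‖y‖ ≤ noiseConst t δ * ε + approxConst t δ * (2 * σ / √k) := by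
  classical
  obtain ⟨q, rfl⟩ : ∃ q, t = q + 1 := ⟨t - 1, by omega⟩
  have hq : 1 ≤ q := by omega
  have hq' : (1 : ℝ) ≤ q := by exact_mod_cast hq
  have hk' : (1 : ℝ) ≤ k := by exact_mod_cast hk
  have hsk : 0 < √(k : ℝ) := Real.sqrt_pos.2 (by linarith)
  have hsk2 : √(k : ℝ) ^ 2 = k := Real.sq_sqrt (by linarith)
  set P := 2 * σ / √k with hP
  have hP0 : 0 ≤ P := by positivity
  have hPσ : √k * P = 2 * σ := by rw [hP]; field_simp
  set L := ∑ i ∈ H, |h i| with hL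
  have hL0 : 0 ≤ L := Finset.sum_nonneg fun i _ => abs_nonneg _
  -- The threshold is the cone bound on the `ℓ₁`-norm off `H`, divided by `k q = k (t - 1)`. Hence
  -- at most `k q` entries off `H` exceed it.
  set κ := (L + 2 * σ) / k / q with hκ
  have hκ0 : 0 ≤ κ := by positivity
  have hκq : (k : ℝ) * q * κ = L + 2 * σ := by rw [hκ]; field_simp
  set H₁ := Finset.univ.filter fun i => i ∉ H ∧ κ < |h i| with hH₁
  have hH₁c : H₁ ⊆ Hᶜ := fun i hi => by simp [hH₁] at hi; simp [hi.1]
  have hsumc : ∑ i ∈ H₁, |h i| + ∑ i ∈ Hᶜ \ H₁, |h i| = ∑ i ∈ Hᶜ, |h i| := by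
    rw [add_comm, Finset.sum_sdiff hH₁c]
  have hH₁le : (H₁.card : ℝ) * κ ≤ ∑ i ∈ H₁, |h i| := by
    rw [← nsmul_eq_mul]
    exact Finset.card_nsmul_le_sum _ _ _ fun i hi => by simp [hH₁] at hi; exact hi.2.le
  have hm : H₁.card ≤ k * q := by
    by_contra hcon
    push Not at hcon
    have hne : H₁.Nonempty := Finset.card_pos.1 (by omega)
    have h1 : (H₁.card : ℝ) * κ < ∑ i ∈ H₁, |h i| := by
      rw [← nsmul_eq_mul, ← Finset.sum_const]
      exact Finset.sum_lt_sum_of_nonempty hne fun i hi => by simp [hH₁] at hi; exact hi.2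
    have h2 : (k : ℝ) * q * κ ≤ (H₁.card : ℝ) * κ := by
      have : (k : ℝ) * q ≤ H₁.card := by exact_mod_cast hcon.le
      gcongr
    have h3 : 0 ≤ ∑ i ∈ Hᶜ \ H₁, |h i| := Finset.sum_nonneg fun i _ => abs_nonneg _
    linarith
  -- The sparsity left for the test vectors: `k + |H₁|` entries of `b` and `s` further ones make `k
  -- + k q = t k`.
  obtain ⟨s, hs⟩ : ∃ s, H₁.card + s = k * q := ⟨k * q - H₁.card, by omega⟩
  have hs' : (H₁.card : ℝ) + s = k * q := by exact_mod_cast hs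
  set T := H ∪ H₁ with hT
  set b : Fin N → ℝ := fun i => if i ∈ T then h i else 0 with hb
  set v : Fin N → ℝ := fun i => if i ∈ T then 0 else h i with hv
  have hbv : b + v = h := by
    ext i
    by_cases hi : i ∈ T <;> simp [hb, hv, hi]
  have hbsp : IsSparse (k + H₁.card) b := by
    refine le_trans (Finset.card_le_card (t := T) fun i hi => ?_)
      ((Finset.card_union_le _ _).trans (by rw [hHk]))
    by_contra hcon
    simp [hb, hcon] at hi
  have hvκ : ∀ i, |v i| ≤ κ := by
    intro i
    by_cases hi : i ∈ T
    · simpa [hv, hi] using hκ0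
    · simp only [hv, hi, if_false]
      simp only [hT, hH₁, Finset.mem_union, Finset.mem_filter, Finset.mem_univ, true_and, not_or,
        not_and, not_lt] at hi
      exact hi.2 hi.1
  have hv1 : ∑ i, |v i| ≤ s * κ := by
    have : ∑ i, |v i| = ∑ i ∈ Hᶜ \ H₁, |h i| := by
      have e : Hᶜ \ H₁ = Tᶜ := by ext i; simp [hT]
      rw [e, ← Finset.sum_add_sum_compl T, Finset.sum_eq_zero, zero_add]
      · refine Finset.sum_congr rfl fun i hi => ?_
        rw [Finset.mem_compl] at hi
        simp [hv, hi]
      · intro i hi; simp [hv, hi]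
    rw [this]
    have : (s : ℝ) * κ = k * q * κ - H₁.card * κ := by rw [← hs']; ring
    linarith
  set X := √(∑ i ∈ T, h i ^ 2) with hX
  have hX0 : 0 ≤ X := Real.sqrt_nonneg _
  have hX2 : X ^ 2 = ∑ i ∈ T, h i ^ 2 := Real.sq_sqrt (Finset.sum_nonneg fun i _ => sq_nonneg _)
  have hbb : b ⬝ᵥ b = X ^ 2 := by
    rw [hX2, dotProduct, ← Finset.sum_filter_add_sum_filter_not _ (· ∈ T)]
    rw [Finset.sum_eq_zero (s := Finset.univ.filter (· ∉ T)), add_zero]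
    · refine Finset.sum_congr (by ext; simp) fun i hi => by
        simp [hb, hi, sq]
    · intro i hi
      simp at hi
      simp [hb, hi]
  have hbh : b ⬝ᵥ h = X ^ 2 := by
    rw [← hbb, dotProduct, dotProduct]
    refine Finset.sum_congr rfl fun i _ => ?_
    by_cases hi : i ∈ T <;> simp [hb, hi]
  have hHX : ∑ i ∈ H, h i ^ 2 ≤ X ^ 2 := by
    rw [hX2]
    exact Finset.sum_le_sum_of_subset_of_nonneg Finset.subset_union_left
      fun i _ _ => sq_nonneg _
  have hLX : L ≤ √k * X := by
    refine le_of_sq_le_sq ?_ (by positivity)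
    have := sq_sum_le_card_mul_sum_sq (s := H) (f := fun i => |h i|)
    simp only [sq_abs, hHk] at this
    rw [mul_pow, hsk2]
    exact this.trans (mul_le_mul_of_nonneg_left hHX (by positivity))
  set r := √((((q + 1 : ℕ) : ℝ) - 1) / (q + 1 : ℕ)) with hr
  have hqr : (((q + 1 : ℕ) : ℝ) - 1) / (q + 1 : ℕ) = q / (q + 1) := by push_cast; ring
  have hr2 : r ^ 2 = q / (q + 1) := by
    rw [hr, hqr, Real.sq_sqrt (by positivity)]
  have hr0 : 0 < r := hδ.trans_lt hδt
  have hr1 : r < 1 := by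
    have : r ^ 2 < 1 := by rw [hr2, div_lt_one (by positivity)]; linarith
    exact (sq_lt_one_iff₀ hr0.le).1 this
  have hRle : (s : ℝ) * κ ^ 2 ≤ (X + P) ^ 2 * ((1 - r ^ 2) / r ^ 2) := by
    have e : (1 - r ^ 2) / r ^ 2 = 1 / q := by rw [hr2]; field_simp; ring
    rw [e, mul_one_div, le_div_iff₀ (by positivity)]
    have h1 : (s : ℝ) ≤ k * q := by linarith [Nat.cast_nonneg (α := ℝ) H₁.card]
    have h2 : √k * q * κ ≤ X + P := by
      refine le_of_mul_le_mul_left ?_ hsk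
      calc √k * (√k * q * κ) = √k ^ 2 * q * κ := by ring
        _ = L + 2 * σ := by rw [hsk2, hκq]
        _ ≤ √k * (X + P) := by rw [mul_add, hPσ]; linarith
    calc (s : ℝ) * κ ^ 2 * q ≤ k * q * κ ^ 2 * q := by gcongr
      _ = (√k * q * κ) ^ 2 := by rw [mul_pow, mul_pow, hsk2]; ring
      _ ≤ (X + P) ^ 2 := by gcongr
  have hquad := restricted_isometry_quadratic (Dl := Dl) (Al := Al) (b := b) (v := v) (y := y)
    (by rw [hbv, hy]) hX0 (by rw [hin, hbh])
    (by
      refine le_of_sq_le_sq ?_ hX0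
      exact (hcontr b).trans hbb.le) hcontr (j := k + H₁.card) (s := s) (l := (q + 1) * k)
    -- This `μ` equals `√(t (t - 1)) - (t - 1)`; it is at most `1/2` because `r < 1`.
    (by rw [add_assoc, hs]; exact le_of_eq (by ring)) hbsp hvκ hv1 hδ (μ := r / (1 + r))
    (by positivity) (by rw [div_le_div_iff₀ (by positivity) (by positivity)]; linarith) hR hε
  have hε0 : 0 ≤ ε := (norm_nonneg _).trans hε
  have hXle := le_of_restricted_isometry_quadratic hr0 hr1 hδ hδt hε0 hP0 hRle hquad
  have hyX : ‖y‖ ≤ √2 * X + P := by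
    refine le_of_sq_le_sq ?_ (by positivity)
    have hyh : ‖y‖ ^ 2 = ∑ i ∈ H, h i ^ 2 + ∑ i ∈ Hᶜ, h i ^ 2 := by
      rw [Finset.sum_add_sum_compl, ← real_inner_self_eq_norm_sq]
      nth_rw 1 [← hy]
      rw [hin, dotProduct]
      exact Finset.sum_congr rfl fun i _ => (sq _).symm
    have h1 := sum_compl_sq_le hHk hk htop hσ hcone hX0 hLX
    rw [← hP] at h1
    have h2 : √2 ^ 2 = (2 : ℝ) := Real.sq_sqrt (by norm_num)
    have h3 : (1 : ℝ) ≤ √2 := Real.one_le_sqrt.2 (by norm_num)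
    have h4 : X * P ≤ √2 * (X * P) := le_mul_of_one_le_left (by positivity) h3
    rw [hyh]
    calc _ ≤ X ^ 2 + X * (X + P) := add_le_add hHX h1
      _ ≤ √2 ^ 2 * X ^ 2 + 2 * (√2 * (X * P)) + P ^ 2 := by
          rw [h2]; linarith only [h4, mul_nonneg hX0 hP0, sq_nonneg P]
      _ = (√2 * X + P) ^ 2 := by ring
  refine hyX.trans ?_
  rw [← sqrt_two_mul_add_eq_noiseConst_approxConst (t := (q + 1 : ℕ)) (by push_cast; linarith) hr
    hδ hδt]
  gcongr

end Recovery

/-! ### From the S-DRIP to phaseless recovery -/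

section Phaseless

lemma l2norm_sq {ι : Type*} [Fintype ι] (x : ι → ℝ) : l2norm x ^ 2 = ∑ i, x i ^ 2 := by
  simp [l2norm, EuclideanSpace.norm_sq_eq]

lemma l2norm_rowRestrict_mulVec_sq {m n : ℕ} (A : Matrix (Fin m) (Fin n) ℝ) (I : Finset (Fin m))
    (x : Fin n → ℝ) : l2norm (rowRestrict A I *ᵥ x) ^ 2 = ∑ i ∈ I, (A *ᵥ x) i ^ 2 := by
  rw [l2norm_sq, ← Finset.sum_coe_sort I fun i => (A *ᵥ x) i ^ 2]
  rfl

lemma bestApproxError_nonneg {N : ℕ} (k : ℕ) (y : Fin N → ℝ) : 0 ≤ bestApproxError k y :=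
  Real.sInf_nonneg (by rintro _ ⟨z, _, rfl⟩; exact Finset.sum_nonneg fun i _ => abs_nonneg _)

lemma inner_toLp_toLp {ι : Type*} [Fintype ι] (x y : ι → ℝ) :
    inner ℝ (WithLp.toLp 2 x) (WithLp.toLp 2 y) = x ⬝ᵥ y := by
  simp [PiLp.inner_apply, dotProduct, mul_comm]

/-- Recovery of a single vector from the S-DRIP, with one fixed set of rows. -/
lemma l2norm_le_of_sdrip {m n N k t : ℕ} {A : Matrix (Fin m) (Fin n) ℝ}
    {D : Matrix (Fin n) (Fin N) ℝ} {a θm θp : ℝ} (hD : IsTightFrame D a) (hk : 1 ≤ k) (hkN : k ≤ N)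
    (ht : 2 ≤ t) (hδ : 0 ≤ max (1 - θm) (θp - 1))
    (hδt : max (1 - θm) (θp - 1) < √(((t : ℝ) - 1) / t))
    (hA : SDRIP A D (t * k) θm θp) {I : Finset (Fin m)} (hI : (m : ℝ) / 2 ≤ I.card)
    {x y : Fin n → ℝ} (hxy : l1norm (Dᵀ *ᵥ (x + y)) ≤ l1norm (Dᵀ *ᵥ x)) {ε : ℝ}
    (hε : l2norm (rowRestrict A I *ᵥ y) ≤ ε) :
    l2norm y ≤ noiseConst t (max (1 - θm) (θp - 1)) * ε +
      approxConst t (max (1 - θm) (θp - 1)) / √a * (2 * bestApproxError k (Dᵀ *ᵥ x) / √k) := by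
  set δ := max (1 - θm) (θp - 1) with hδdef
  obtain ⟨ha, hD⟩ := hD
  have hsa : 0 < √a := Real.sqrt_pos.2 ha
  have hsa2 : √a ^ 2 = a := Real.sq_sqrt ha.le
  obtain ⟨H, hHk, htop, hmax⟩ := exists_top_entries (Dᵀ *ᵥ y) hkN
  rw [Matrix.mulVec_add] at hxy
  have hcone := sum_compl_le_of_l1norm_add_le hxy hmax
  have hpol : ∀ w z : Fin n → ℝ, (Dᵀ *ᵥ w) ⬝ᵥ (Dᵀ *ᵥ z) = a * (w ⬝ᵥ z) := by
    intro w z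
    have h1 := hD (w + z)
    have h2 := hD (w - z)
    simp only [l2norm_sq, Matrix.mulVec_add, Matrix.mulVec_sub, Pi.add_apply, Pi.sub_apply] at h1 h2
    have e : ∀ {ι : Type} [Fintype ι] (u v : ι → ℝ), ∑ i, (u i + v i) ^ 2 - ∑ i, (u i - v i) ^ 2 =
        4 * (u ⬝ᵥ v) := by
      intro ι _ u v
      rw [dotProduct, ← Finset.sum_sub_distrib, Finset.mul_sum]
      exact Finset.sum_congr rfl fun i _ => by ring
    have h3 := e (Dᵀ *ᵥ w) (Dᵀ *ᵥ z)
    have h4 := e w z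
    linear_combination (h1 - h2 - h3 + a * h4) / 4
  have hDD : ∀ w : Fin n → ℝ, D *ᵥ (Dᵀ *ᵥ w) = a • w := by
    intro w
    refine dotProduct_eq_iff.1 ?_
    intro z
    rw [dotProduct_comm, Matrix.dotProduct_mulVec, ← Matrix.mulVec_transpose, hpol,
      smul_dotProduct, smul_eq_mul, dotProduct_comm]
  -- Dividing by `√a` turns the tight frame into a Parseval frame; this is the source of the factor
  -- `1 / √a` in the approximation term.
  let Dl : (Fin N → ℝ) →ₗ[ℝ] EuclideanSpace ℝ (Fin n) :=
    (√a)⁻¹ • ((WithLp.linearEquiv 2 ℝ (Fin n → ℝ)).symm.toLinearMap ∘ₗ D.mulVecLin)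
  let Al : EuclideanSpace ℝ (Fin n) →ₗ[ℝ] EuclideanSpace ℝ I :=
    (WithLp.linearEquiv 2 ℝ (I → ℝ)).symm.toLinearMap ∘ₗ (rowRestrict A I).mulVecLin ∘ₗ
      (WithLp.linearEquiv 2 ℝ (Fin n → ℝ)).toLinearMap
  have hDl : ∀ u, Dl u = WithLp.toLp 2 ((√a)⁻¹ • (D *ᵥ u)) := fun u => rfl
  have hAl : ∀ w : Fin n → ℝ, ‖Al (WithLp.toLp 2 w)‖ = l2norm (rowRestrict A I *ᵥ w) :=
    fun w => rfl
  have hDln : ∀ u, ‖Dl u‖ = (√a)⁻¹ * l2norm (D *ᵥ u) := by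
    intro u
    rw [hDl, WithLp.toLp_smul, norm_smul, Real.norm_of_nonneg (by positivity)]
    rfl
  have hADln : ∀ u, ‖Al (Dl u)‖ = (√a)⁻¹ * l2norm (rowRestrict A I *ᵥ (D *ᵥ u)) := by
    intro u
    rw [hDl, hAl, Matrix.mulVec_smul, l2norm, WithLp.toLp_smul, norm_smul,
      Real.norm_of_nonneg (by positivity)]
    rfl
  have hmain := norm_le_of_restricted_isometry (Dl := Dl) (Al := Al)
    (h := (√a)⁻¹ • (Dᵀ *ᵥ y)) (y := WithLp.toLp 2 y) (by
      rw [hDl, Matrix.mulVec_smul, hDD, smul_smul, smul_smul]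
      have : (√a)⁻¹ * (√a)⁻¹ * a = 1 := by
        rw [← mul_inv, ← sq, hsa2, inv_mul_cancel₀ ha.ne']
      rw [this, one_smul]) (by
      intro u
      rw [hDl, inner_toLp_toLp, smul_dotProduct, dotProduct_smul, Matrix.mulVec_transpose,
        dotProduct_comm u, ← Matrix.dotProduct_mulVec, dotProduct_comm]) (by
      intro u
      have h1 : ‖Dl u‖ ^ 2 = u ⬝ᵥ ((a⁻¹) • (Dᵀ *ᵥ (D *ᵥ u))) := by
        rw [← real_inner_self_eq_norm_sq, hDl, inner_toLp_toLp, smul_dotProduct, dotProduct_smul,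
          dotProduct_smul, smul_smul, ← mul_inv, ← sq, hsa2, Matrix.mulVec_transpose,
          dotProduct_comm u, ← Matrix.dotProduct_mulVec]
      have h2 : (a⁻¹ • (Dᵀ *ᵥ (D *ᵥ u))) ⬝ᵥ (a⁻¹ • (Dᵀ *ᵥ (D *ᵥ u))) = ‖Dl u‖ ^ 2 := by
        rw [smul_dotProduct, dotProduct_smul, hpol, ← real_inner_self_eq_norm_sq, hDl,
          inner_toLp_toLp, smul_dotProduct, dotProduct_smul, smul_smul, smul_smul,
          ← mul_inv (√a), ← sq (√a), hsa2, smul_eq_mul, smul_eq_mul]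
        field_simp
      -- `z` is the orthogonal projection of `u` onto the range of `Dᵀ`, so its squared norm `‖Dl
      -- u‖²` is at most that of `u`.
      set z := a⁻¹ • (Dᵀ *ᵥ (D *ᵥ u)) with hz
      have h3 : 0 ≤ (u - z) ⬝ᵥ (u - z) := Finset.sum_nonneg fun i _ => mul_self_nonneg _
      rw [sub_dotProduct, dotProduct_sub, dotProduct_sub, dotProduct_comm z u, h2, ← h1] at h3
      linarith) hk ht (σ := (√a)⁻¹ * bestApproxError k (Dᵀ *ᵥ x)) hδ hδt
      (mul_nonneg (by positivity) (bestApproxError_nonneg _ _)) hHk (by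
      intro i hi j hj
      simp only [Pi.smul_apply, smul_eq_mul, abs_mul]
      exact mul_le_mul_of_nonneg_left (htop i hi j hj) (abs_nonneg _)) (by
      simp only [Pi.smul_apply, smul_eq_mul, abs_mul, ← Finset.mul_sum]
      rw [abs_of_nonneg (by positivity : 0 ≤ (√a)⁻¹)]
      have := mul_le_mul_of_nonneg_left hcone (by positivity : 0 ≤ (√a)⁻¹)
      linarith) (by
      intro u hu
      obtain ⟨h1, h2⟩ := hA u hu I hI
      rw [hDln, hADln, mul_pow, mul_pow, mul_left_comm, mul_left_comm (1 + δ)]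
      have hn := sq_nonneg (l2norm (D *ᵥ u))
      constructor
      · refine mul_le_mul_of_nonneg_left (le_trans ?_ h1) (by positivity)
        exact mul_le_mul_of_nonneg_right (by linarith [le_max_left (1 - θm) (θp - 1)]) hn
      · refine mul_le_mul_of_nonneg_left (le_trans h2 ?_) (by positivity)
        exact mul_le_mul_of_nonneg_right (by linarith [le_max_right (1 - θm) (θp - 1)]) hn)
      (ε := ε) hε
  refine le_trans hmain (le_of_eq ?_)
  field_simp

/-- The S-DRIP implies stable phaseless recovery. -/
theorem SDRIP.stableRecovery {m n N k t : ℕ} {A : Matrix (Fin m) (Fin n) ℝ}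
    {D : Matrix (Fin n) (Fin N) ℝ} {a θm θp : ℝ} (hD : IsTightFrame D a) (hk : 1 ≤ k) (hkN : k ≤ N)
    (ht : 2 ≤ t) (hδ : 0 ≤ max (1 - θm) (θp - 1))
    (hδt : max (1 - θm) (θp - 1) < √(((t : ℝ) - 1) / t))
    (hA : SDRIP A D (t * k) θm θp) :
    StableRecovery A D k (noiseConst t (max (1 - θm) (θp - 1)))
      (approxConst t (max (1 - θm) (θp - 1)) / √a) := by
  classical
  intro x₀ _ ε hε xh ⟨hfeas, hmin⟩
  have hl1 : l1norm (Dᵀ *ᵥ xh) ≤ l1norm (Dᵀ *ᵥ x₀) :=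
    hmin x₀ (by simpa [feasibleSet, l2norm_sq] using sq_nonneg ε)
  simp only [feasibleSet, Set.mem_ofPred_eq, l2norm_sq] at hfeas
  set I := Finset.univ.filter fun j => 0 ≤ (A *ᵥ xh) j * (A *ᵥ x₀) j with hI
  have hcard : (I.card : ℝ) + Iᶜ.card = m := by
    exact_mod_cast (Finset.card_add_card_compl I).trans (by simp)
  have hle : ∀ (J : Finset (Fin m)) (y : Fin n → ℝ),
      (∀ j ∈ J, (A *ᵥ y) j ^ 2 = (|(A *ᵥ xh) j| - |(A *ᵥ x₀) j|) ^ 2) →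
      l2norm (rowRestrict A J *ᵥ y) ≤ ε := by
    intro J y hy
    refine le_of_sq_le_sq ?_ hε
    rw [l2norm_rowRestrict_mulVec_sq, Finset.sum_congr rfl hy]
    exact (Finset.sum_le_sum_of_subset_of_nonneg (Finset.subset_univ _)
      fun _ _ _ => sq_nonneg _).trans hfeas
  have hsq : ∀ p q : ℝ, (|p| - |q|) ^ 2 = p ^ 2 + q ^ 2 - 2 * |p * q| := by
    intro p q; rw [sub_sq, sq_abs, sq_abs, abs_mul]; ring
  rcases le_or_gt ((m : ℝ) / 2) I.card with h | h
  · refine (min_le_left _ _).trans ?_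
    refine l2norm_le_of_sdrip hD hk hkN ht hδ hδt hA h (by simpa using hl1) (hle _ _ ?_)
    intro j hj
    have hj' : 0 ≤ (A *ᵥ xh) j * (A *ᵥ x₀) j := by simpa [hI] using hj
    rw [hsq, abs_of_nonneg hj', Matrix.mulVec_sub, Pi.sub_apply]
    ring
  · refine (min_le_right _ _).trans ?_
    -- Signs disagree on more than half of the rows, so `-xh`, which has the same objective value,
    -- takes the role of `xh`.
    have e : l2norm (xh + x₀) = l2norm (-xh - x₀) := by
      rw [l2norm, l2norm, ← norm_neg, ← WithLp.toLp_neg, neg_add, sub_eq_add_neg]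
    rw [e]
    refine l2norm_le_of_sdrip (I := Iᶜ) hD hk hkN ht hδ hδt hA (by linarith) ?_ (hle _ _ ?_)
    · simpa [Matrix.mulVec_neg, l1norm] using hl1
    intro j hj
    have hj' : (A *ᵥ xh) j * (A *ᵥ x₀) j < 0 := by simpa [hI] using hj
    rw [hsq, abs_of_neg hj', Matrix.mulVec_sub, Matrix.mulVec_neg, Pi.sub_apply, Pi.neg_apply]
    ring

end Phaseless

/-! ### Gaussian concentration for a fixed vector -/

section Gaussian

/-- The characteristic function factorizes over the coordinates, and the variances `v x i ^ 2` add
up to `v`. -/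
lemma map_dotProduct_pi_gaussianReal {n : ℕ} (v : ℝ≥0) {x : Fin n → ℝ} (hx : l2norm x = 1) :
    (Measure.pi fun _ : Fin n => gaussianReal 0 v).map (fun a => a ⬝ᵥ x) = gaussianReal 0 v := by
  have hm : Measurable fun a : Fin n → ℝ => a ⬝ᵥ x := by
    unfold dotProduct; fun_prop
  have := Measure.isProbabilityMeasure_map
    (μ := Measure.pi fun _ : Fin n => gaussianReal 0 v) hm.aemeasurable
  refine Measure.ext_of_charFun (funext fun t => ?_)
  rw [charFun_apply_real, integral_map hm.aemeasurable (by fun_prop)]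
  have h1 : ∀ a : Fin n → ℝ, Complex.exp (t * ((a ⬝ᵥ x : ℝ) : ℂ) * Complex.I) =
      ∏ i, Complex.exp (((t * x i : ℝ) : ℂ) * ((a i : ℝ) : ℂ) * Complex.I) := by
    intro a
    rw [← Complex.exp_sum, dotProduct]
    push_cast
    rw [Finset.mul_sum, Finset.sum_mul]
    congr 1
    exact Finset.sum_congr rfl fun i _ => by ring
  simp_rw [h1]
  rw [integral_fintype_prod_eq_prod (𝕜 := ℂ)
    (fun i (y : ℝ) => Complex.exp (((t * x i : ℝ) : ℂ) * (y : ℂ) * Complex.I))]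
  simp_rw [← charFun_apply_real, charFun_gaussianReal]
  rw [← Complex.exp_sum]
  have h2 : ∑ i, x i ^ 2 = 1 := by rw [← l2norm_sq, hx, one_pow]
  have h3 : ∑ i, (x i : ℂ) ^ 2 = 1 := by exact_mod_cast h2
  congr 1
  push_cast
  simp only [mul_zero, zero_mul, zero_sub, mul_pow]
  rw [Finset.sum_neg_distrib, ← Finset.sum_div, ← Finset.mul_sum, ← Finset.mul_sum, h3, mul_one]

lemma integral_exp_mul_sq_gaussianReal {v : ℝ≥0} (hv : v ≠ 0) {s : ℝ} (hs : 2 * s * v < 1) :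
    ∫ g, Real.exp (s * g ^ 2) ∂(gaussianReal 0 v) = √(1 / (1 - 2 * s * v)) := by
  have hv0 : (0 : ℝ) < v := by positivity
  rw [integral_gaussianReal_eq_integral_smul hv]
  have h : ∀ g : ℝ, gaussianPDFReal 0 v g • Real.exp (s * g ^ 2) =
      (√(2 * Real.pi * v))⁻¹ * Real.exp (-(1 / (2 * v) - s) * g ^ 2) := by
    intro g
    rw [gaussianPDFReal, smul_eq_mul, mul_assoc, ← Real.exp_add]
    congr 2
    field_simp
    ring
  simp_rw [h]
  rw [integral_const_mul, integral_gaussian, ← Real.sqrt_inv, ← Real.sqrt_mul (by positivity)]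
  congr 1
  have h1 : 1 - 2 * s * v ≠ 0 := by linarith
  have h2 : 1 / (2 * (v : ℝ)) - s = (1 - 2 * s * v) / (2 * v) := by field_simp
  rw [h2]
  field_simp

/-- The exponential Markov inequality for the energy of a unit vector on a set of rows. -/
lemma gaussianMatrixLaw_le_exp_mul {m n : ℕ} (hm : m ≠ 0) {x : Fin n → ℝ} (hx : l2norm x = 1)
    (I : Finset (Fin m)) {s : ℝ} (hs : 2 * s < 1) (τ : ℝ) :
    gaussianMatrixLaw m n {A | τ ≤ s * m * ∑ i ∈ I, (Matrix.of A *ᵥ x) i ^ 2} ≤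
      ENNReal.ofReal (Real.exp (-τ) * √(1 / (1 - 2 * s)) ^ I.card) := by
  classical
  have hm' : (0 : ℝ) < m := by positivity
  set v : ℝ≥0 := (1 : ℝ≥0) / (m : ℝ≥0) with hv
  have hv0 : v ≠ 0 := by positivity
  have hvm : (m : ℝ) * v = 1 := by
    rw [hv]; push_cast; field_simp
  have : IsProbabilityMeasure (gaussianMatrixLaw m n) := by
    unfold gaussianMatrixLaw; infer_instance
  have hmeas : Measurable fun a : Fin n → ℝ => a ⬝ᵥ x := by
    unfold dotProduct; fun_prop
  have hrow : ∫ a, Real.exp (s * m * (a ⬝ᵥ x) ^ 2) ∂(Measure.pi fun _ : Fin n => gaussianReal 0 v) =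
      √(1 / (1 - 2 * s)) := by
    rw [← integral_map (φ := fun a : Fin n → ℝ => a ⬝ᵥ x) (f := fun g => Real.exp (s * m * g ^ 2))
      hmeas.aemeasurable (by fun_prop), map_dotProduct_pi_gaussianReal v hx,
      integral_exp_mul_sq_gaussianReal hv0]
    · congr 3
      linear_combination 2 * s * hvm
    · calc 2 * (s * m) * v = 2 * s * (m * v) := by ring
        _ < 1 := by rw [hvm, mul_one]; exact hs
  have hint : ∫ A, Real.exp (1 * (s * m * ∑ i ∈ I, (Matrix.of A *ᵥ x) i ^ 2))
      ∂(gaussianMatrixLaw m n) = √(1 / (1 - 2 * s)) ^ I.card := by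
    have h1 : ∀ A : Fin m → Fin n → ℝ,
        Real.exp (1 * (s * m * ∑ i ∈ I, (Matrix.of A *ᵥ x) i ^ 2)) =
        ∏ i, (if i ∈ I then Real.exp (s * m * (A i ⬝ᵥ x) ^ 2) else 1) := by
      intro A
      rw [one_mul, Finset.mul_sum, Real.exp_sum, Finset.prod_ite_mem, Finset.univ_inter]
      rfl
    simp_rw [h1]
    rw [gaussianMatrixLaw, integral_fintype_prod_eq_prod (𝕜 := ℝ)
      (fun i (a : Fin n → ℝ) => if i ∈ I then Real.exp (s * m * (a ⬝ᵥ x) ^ 2) else 1)]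
    have h2 : ∀ i, ∫ a, (if i ∈ I then Real.exp (s * m * (a ⬝ᵥ x) ^ 2) else 1)
        ∂(Measure.pi fun _ : Fin n => gaussianReal 0 v) =
        if i ∈ I then √(1 / (1 - 2 * s)) else 1 := by
      intro i
      split_ifs
      · exact hrow
      · simp
    simp_rw [← hv, h2]
    simp
  -- Integrability comes for free: a non-integrable function would have integral `0`, but the
  -- integral is positive.
  have hpos : 0 < √(1 / (1 - 2 * s)) ^ I.card :=
    pow_pos (Real.sqrt_pos.2 (one_div_pos.2 (by linarith))) _
  have hmarkov := measure_ge_le_exp_mul_mgf (μ := gaussianMatrixLaw m n)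
    (X := fun A => s * m * ∑ i ∈ I, (Matrix.of A *ᵥ x) i ^ 2) (t := 1) τ zero_le_one (by
      by_contra hcon
      rw [integral_undef hcon] at hint
      exact hpos.ne hint)
  rw [mgf, hint, neg_one_mul] at hmarkov
  rw [← ofReal_measureReal]
  exact ENNReal.ofReal_le_ofReal hmarkov

lemma exp_mul_sqrt_pow_le (m : ℕ) :
    Real.exp (-(m / 4)) * √(1 / (1 - 2 * (1 / 6))) ^ m ≤ Real.exp (-(m / 25)) := by
  have h1 : √(1 / (1 - 2 * (1 / 6))) ≤ Real.exp (21 / 100) := by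
    rw [Real.sqrt_le_left (by positivity), ← Real.exp_nat_mul]
    have := Real.quadratic_le_exp_of_nonneg (x := ((2 : ℕ) : ℝ) * (21 / 100)) (by norm_num)
    refine le_trans ?_ this
    norm_num
  calc _ ≤ Real.exp (-(m / 4)) * Real.exp (21 / 100) ^ m := by gcongr
    _ = Real.exp (-(m / 25)) := by
        rw [← Real.exp_nat_mul, ← Real.exp_add]
        congr 1
        ring

/-- The small-ball estimate beats the number of row sets because `2 e / 10 < 1`. -/
lemma two_pow_mul_exp_mul_le (m : ℕ) :
    (2 : ℝ) ^ m * (Real.exp m * (1 / 10) ^ m) ≤ Real.exp (-(m / 25)) := by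
  have h1 : 2 * (Real.exp 1 * (1 / 10)) ≤ Real.exp (-(1 / 25)) := by
    have h2 := Real.exp_one_lt_d9
    have h3 := Real.add_one_le_exp (-(1 / 25 : ℝ))
    linarith
  calc _ = (2 * (Real.exp 1 * (1 / 10))) ^ m := by
        rw [mul_pow, mul_pow, ← Real.exp_nat_mul, mul_one]
    _ ≤ Real.exp (-(1 / 25)) ^ m := by gcongr
    _ = _ := by rw [← Real.exp_nat_mul]; congr 1; ring

/-- The matrices that distort the unit vector `x`: the energy of all rows is too large, or that of
some half of the rows is too small. -/
def distortingSet (m : ℕ) {n : ℕ} (x : Fin n → ℝ) : Set (Fin m → Fin n → ℝ) :=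
  {A | 3 / 2 ≤ ∑ i, (Matrix.of A *ᵥ x) i ^ 2 ∨ ∃ I : Finset (Fin m), (m : ℝ) / 2 ≤ I.card ∧
    ∑ i ∈ I, (Matrix.of A *ᵥ x) i ^ 2 ≤ 1 / 5000}

lemma gaussianMatrixLaw_distortingSet_le {m n : ℕ} (hm : m ≠ 0) {x : Fin n → ℝ}
    (hx : l2norm x = 1) :
    gaussianMatrixLaw m n (distortingSet m x) ≤ ENNReal.ofReal (2 * Real.exp (-(m / 25))) := by
  classical
  have hm' : (0 : ℝ) < m := by positivity
  have h1 : gaussianMatrixLaw m n {A | 3 / 2 ≤ ∑ i, (Matrix.of A *ᵥ x) i ^ 2} ≤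
      ENNReal.ofReal (Real.exp (-(m / 25))) := by
    have := gaussianMatrixLaw_le_exp_mul hm hx Finset.univ (s := 1 / 6) (by norm_num) (m / 4)
    rw [Finset.card_univ, Fintype.card_fin] at this
    refine (measure_mono fun A hA => ?_).trans
      (this.trans (ENNReal.ofReal_le_ofReal (exp_mul_sqrt_pow_le m)))
    simp only [Set.mem_ofPred_eq] at hA ⊢
    have := mul_le_mul_of_nonneg_left hA hm'.le
    linarith
  set S := Finset.univ.filter fun I : Finset (Fin m) => (m : ℝ) / 2 ≤ I.card with hS
  have h2 : ∀ I ∈ S, gaussianMatrixLaw m n {A | ∑ i ∈ I, (Matrix.of A *ᵥ x) i ^ 2 ≤ 1 / 5000} ≤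
      ENNReal.ofReal (Real.exp m * (1 / 10) ^ m) := by
    intro I hI
    have hI' : (m : ℝ) / 2 ≤ I.card := by simpa [hS] using hI
    -- Here `1 - 2 s = 10 ^ 4`, so each row contributes a factor `1 / 100` and half of the rows give
    -- `(1 / 10) ^ m`. The threshold `1 / 5000` keeps the exponent above `-m`.
    have := gaussianMatrixLaw_le_exp_mul hm hx I (s := -(9999 / 2)) (by norm_num) (-m)
    have e : √(1 / (1 - 2 * (-(9999 / 2) : ℝ))) = (1 / 10) ^ 2 := by
      rw [Real.sqrt_eq_iff_mul_self_eq (by norm_num) (by norm_num)]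
      norm_num
    rw [e, neg_neg, ← pow_mul] at this
    refine (measure_mono fun A hA => ?_).trans (this.trans (ENNReal.ofReal_le_ofReal ?_))
    · simp only [Set.mem_ofPred_eq] at hA ⊢
      have := mul_le_mul_of_nonneg_left hA hm'.le
      linarith
    · refine mul_le_mul_of_nonneg_left (pow_le_pow_of_le_one (by norm_num) (by norm_num) ?_)
        (Real.exp_pos _).le
      have : (m : ℝ) ≤ ((2 * I.card : ℕ) : ℝ) := by push_cast; linarith
      exact_mod_cast this
  have hsub : distortingSet m x ⊆ {A | 3 / 2 ≤ ∑ i, (Matrix.of A *ᵥ x) i ^ 2} ∪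
      ⋃ I ∈ S, {A : Fin m → Fin n → ℝ | ∑ i ∈ I, (Matrix.of A *ᵥ x) i ^ 2 ≤ 1 / 5000} := by
    rintro A (hA | ⟨I, hI, hA⟩)
    · exact Or.inl hA
    · exact Or.inr (Set.mem_biUnion (by simpa [hS] using hI : I ∈ S) hA)
  calc _ ≤ _ := measure_mono hsub
    _ ≤ _ := measure_union_le _ _
    _ ≤ ENNReal.ofReal (Real.exp (-(m / 25))) + ENNReal.ofReal (Real.exp (-(m / 25))) := by
        refine add_le_add h1 ((measure_biUnion_finset_le _ _).trans
          ((Finset.sum_le_sum h2).trans ?_))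
        rw [Finset.sum_const, nsmul_eq_mul, ← ENNReal.ofReal_natCast,
          ← ENNReal.ofReal_mul (by positivity)]
        refine ENNReal.ofReal_le_ofReal (le_trans ?_ (two_pow_mul_exp_mul_le m))
        refine mul_le_mul_of_nonneg_right ?_ (by positivity)
        have : S.card ≤ 2 ^ m := (Finset.card_le_univ _).trans (by simp)
        exact_mod_cast this
    _ = _ := by rw [← ENNReal.ofReal_add (by positivity) (by positivity), two_mul]

end Gaussian

/-! ### Nets of the unit sphere -/

section Net

open Metric Module

variable {E : Type*} [NormedAddCommGroup E] [NormedSpace ℝ E] [FiniteDimensional ℝ E]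

/-- A `ρ`-separated subset of the unit ball has at most `(1 + 2 / ρ) ^ dim` elements. -/
lemma card_le_of_separated {ρ : ℝ} (hρ : 0 < ρ) (s : Finset E) (hs : ∀ c ∈ s, ‖c‖ ≤ 1)
    (h : ∀ c ∈ s, ∀ d ∈ s, c ≠ d → ρ ≤ ‖c - d‖) : (s.card : ℝ) ≤ (1 + 2 / ρ) ^ finrank ℝ E := by
  borelize E
  let μ : Measure E := Measure.addHaar
  have hR : 0 < 1 + ρ / 2 := by positivity
  have hr : 0 < ρ / 2 := by positivity
  have hdisj : Set.Pairwise (s : Set E) (Function.onFun Disjoint fun c => ball (c : E) (ρ / 2)) := by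
    rintro c hc d hd hcd
    apply ball_disjoint_ball
    rw [dist_eq_norm, add_halves]
    exact h c hc d hd hcd
  have hsub : ⋃ c ∈ s, ball (c : E) (ρ / 2) ⊆ ball (0 : E) (1 + ρ / 2) := by
    refine Set.iUnion₂_subset fun x hx => ball_subset_ball' ?_
    rw [dist_zero_right]
    linarith [hs x hx]
  -- Volume comparison: the disjoint balls of radius `ρ / 2` fit in the ball of radius `1 + ρ / 2`.
  have hI : (s.card : ℝ≥0∞) * ENNReal.ofReal ((ρ / 2) ^ finrank ℝ E) * μ (ball 0 1) ≤
      ENNReal.ofReal ((1 + ρ / 2) ^ finrank ℝ E) * μ (ball 0 1) :=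
    calc
      _ = μ (⋃ c ∈ s, ball (c : E) (ρ / 2)) := by
        rw [measure_biUnion_finset hdisj fun c _ => measurableSet_ball]
        simp only [μ.addHaar_ball_of_pos _ hr, Finset.sum_const, nsmul_eq_mul, mul_assoc]
      _ ≤ μ (ball (0 : E) (1 + ρ / 2)) := measure_mono hsub
      _ = _ := by simp only [μ.addHaar_ball_of_pos _ hR]
  have hJ := (ENNReal.mul_le_mul_iff_left (measure_ball_pos _ _ zero_lt_one).ne'
    measure_ball_lt_top.ne).1 hI
  have hK := ENNReal.toReal_le_of_le_ofReal (pow_nonneg hR.le _) hJ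
  rw [ENNReal.toReal_mul, ENNReal.toReal_natCast, ENNReal.toReal_ofReal (by positivity),
    ← le_div_iff₀ (by positivity), ← div_pow] at hK
  refine hK.trans (le_of_eq ?_)
  congr 1
  field_simp
  ring

/-- The unit sphere has a `ρ`-net of at most `(1 + 2 / ρ) ^ dim` elements. -/
lemma exists_net_sphere {ρ : ℝ} (hρ : 0 < ρ) : ∃ s : Finset E, (∀ c ∈ s, ‖c‖ = 1) ∧
    (∀ x : E, ‖x‖ = 1 → ∃ c ∈ s, ‖x - c‖ ≤ ρ) ∧ (s.card : ℝ) ≤ (1 + 2 / ρ) ^ finrank ℝ E := by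
  classical
  let p : ℕ → Prop := fun k => ∃ s : Finset E, s.card = k ∧ (∀ c ∈ s, ‖c‖ = 1) ∧
    ∀ c ∈ s, ∀ d ∈ s, c ≠ d → ρ ≤ ‖c - d‖
  have hbound : ∀ k, p k → k ≤ ⌊(1 + 2 / ρ) ^ finrank ℝ E⌋₊ := by
    rintro k ⟨s, rfl, h1, h2⟩
    exact Nat.le_floor (card_le_of_separated hρ s (fun c hc => (h1 c hc).le) h2)
  -- A separated set of largest cardinality is a net, since an uncovered point could be added to it.
  obtain ⟨s, hcard, h1, h2⟩ : p (Nat.findGreatest p ⌊(1 + 2 / ρ) ^ finrank ℝ E⌋₊) :=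
    Nat.findGreatest_spec (Nat.zero_le _) ⟨∅, by simp⟩
  refine ⟨s, h1, fun x hx => ?_, card_le_of_separated hρ s (fun c hc => (h1 c hc).le) h2⟩
  by_contra! hcon
  have hxs : x ∉ s := fun hxs => by have := hcon x hxs; simp at this; linarith
  have hp : p (s.card + 1) := by
    refine ⟨insert x s, Finset.card_insert_of_notMem hxs, ?_, ?_⟩
    · intro c hc
      rcases Finset.mem_insert.1 hc with rfl | hc
      exacts [hx, h1 c hc]
    · intro c hc d hd hcd
      rcases Finset.mem_insert.1 hc with rfl | hc' <;> rcases Finset.mem_insert.1 hd with rfl | hd'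
      · exact absurd rfl hcd
      · exact (hcon d hd').le
      · rw [norm_sub_rev]; exact (hcon c hc').le
      · exact h2 c hc' d hd' hcd
  have := Nat.le_findGreatest (hbound _ hp) hp
  omega

/-- Approximation by a net point costs `ρ ‖L‖`, which is absorbed on the left because `ρ < 1`. -/
lemma opNorm_le_of_net {E G : Type*} [NormedAddCommGroup E] [NormedSpace ℝ E]
    [NormedAddCommGroup G] [NormedSpace ℝ G] (L : E →L[ℝ] G) {ρ M : ℝ} (hρ0 : 0 ≤ ρ) (hρ : ρ < 1)
    (hM : 0 ≤ M)
    {s : Finset E} (hs : ∀ x : E, ‖x‖ = 1 → ∃ c ∈ s, ‖x - c‖ ≤ ρ) (hL : ∀ c ∈ s, ‖L c‖ ≤ M) :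
    ‖L‖ ≤ M / (1 - ρ) := by
  have h : ‖L‖ ≤ M + ρ * ‖L‖ := by
    refine L.opNorm_le_of_unit_norm (by positivity) fun x hx => ?_
    obtain ⟨c, hc, hxc⟩ := hs x hx
    calc ‖L x‖ = ‖L c + L (x - c)‖ := by rw [← map_add]; congr 2; abel
      _ ≤ ‖L c‖ + ‖L (x - c)‖ := norm_add_le _ _
      _ ≤ M + ρ * ‖L‖ := by
          refine add_le_add (hL c hc) ((L.le_opNorm _).trans ?_)
          rw [mul_comm]
          gcongr
  rw [le_div_iff₀ (by linarith)]
  linarith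

end Net

/-! ### Union bound over supports and nets -/

section UnionBound

open Module

/-- A matrix that distorts no vector of a net of the unit sphere of a subspace preserves the norm
on the subspace, for every half of its rows. -/
lemma energy_bounds_of_net {m n : ℕ} {A : Fin m → Fin n → ℝ}
    {V : Submodule ℝ (EuclideanSpace ℝ (Fin n))} {s : Finset V}
    (hs : ∀ x : V, ‖x‖ = 1 → ∃ c ∈ s, ‖x - c‖ ≤ 1 / 200)
    (hA : ∀ c ∈ s, A ∉ distortingSet m (c : EuclideanSpace ℝ (Fin n)).ofLp)
    {I : Finset (Fin m)} (hI : (m : ℝ) / 2 ≤ I.card) (x : V) :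
    1 / 40000 * ‖x‖ ^ 2 ≤ ∑ i ∈ I, (Matrix.of A *ᵥ (x : EuclideanSpace ℝ (Fin n)).ofLp) i ^ 2 ∧
      ∑ i ∈ I, (Matrix.of A *ᵥ (x : EuclideanSpace ℝ (Fin n)).ofLp) i ^ 2 ≤ 8 / 5 * ‖x‖ ^ 2 := by
  -- Rows outside `J` are set to zero, so that all `L J` have the same codomain. Upper bounds then
  -- need only `J = univ`.
  let L : Finset (Fin m) → V →L[ℝ] EuclideanSpace ℝ (Fin m) := fun J =>
    LinearMap.toContinuousLinearMap ((WithLp.linearEquiv 2 ℝ (Fin m → ℝ)).symm.toLinearMap ∘ₗ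
      (Matrix.of fun i => if i ∈ J then A i else 0).mulVecLin ∘ₗ
      (WithLp.linearEquiv 2 ℝ (Fin n → ℝ)).toLinearMap ∘ₗ V.subtype)
  have hL : ∀ J (z : V), ‖L J z‖ ^ 2 =
      ∑ i ∈ J, (Matrix.of A *ᵥ (z : EuclideanSpace ℝ (Fin n)).ofLp) i ^ 2 := by
    intro J z
    have h1 : ‖L J z‖ ^ 2 = ∑ i, ((if i ∈ J then A i else 0) ⬝ᵥ
        (z : EuclideanSpace ℝ (Fin n)).ofLp) ^ 2 := l2norm_sq _
    rw [h1, ← Finset.sum_filter_add_sum_filter_not _ (· ∈ J),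
      Finset.sum_eq_zero (s := Finset.univ.filter (· ∉ J)), add_zero]
    · refine Finset.sum_congr (by ext; simp) fun i hi => ?_
      rw [if_pos hi]
      rfl
    · intro i hi
      simp only [Finset.mem_filter, Finset.mem_univ, true_and] at hi
      rw [if_neg hi, zero_dotProduct, sq, zero_mul]
  have hmono : ∀ z, ‖L I z‖ ≤ ‖L Finset.univ z‖ := by
    intro z
    refine le_of_sq_le_sq ?_ (norm_nonneg _)
    rw [hL, hL]
    exact Finset.sum_le_sum_of_subset_of_nonneg (Finset.subset_univ _) fun _ _ _ => sq_nonneg _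
  -- `49 / 40` is just above `√(3 / 2)` and `141 / 10000` just below `√(1 / 5000)`. The net error,
  -- about `0.0062`, leaves more than `1 / 200` of the latter.
  have hnet : ∀ c ∈ s, ‖L Finset.univ c‖ ≤ 49 / 40 ∧ 141 / 10000 ≤ ‖L I c‖ := by
    intro c hc
    have h := hA c hc
    simp only [distortingSet, Set.mem_ofPred_eq, not_or, not_exists, not_and, not_le] at h
    constructor
    · refine le_of_sq_le_sq ?_ (by norm_num)
      rw [hL]
      linarith [h.1]
    · refine le_of_sq_le_sq ?_ (norm_nonneg _)
      rw [hL]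
      linarith [h.2 I hI]
  have hop := opNorm_le_of_net (L Finset.univ) (by norm_num) (by norm_num) (by norm_num) hs
    fun c hc => (hnet c hc).1
  have hup : ‖L I x‖ ≤ 49 / 40 / (1 - 1 / 200) * ‖x‖ :=
    (hmono x).trans ((L Finset.univ).le_of_opNorm_le hop x)
  have hlow : 1 / 200 * ‖x‖ ≤ ‖L I x‖ := by
    rcases eq_or_ne x 0 with rfl | hx
    · simp
    have hx0 : 0 < ‖x‖ := norm_pos_iff.2 hx
    obtain ⟨c, hc, hxc⟩ := hs (‖x‖⁻¹ • x) (norm_smul_inv_norm (𝕜 := ℝ) hx)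
    have h1 : ‖L I (‖x‖⁻¹ • x - c)‖ ≤ 49 / 40 / (1 - 1 / 200) * (1 / 200) :=
      (hmono _).trans (((L Finset.univ).le_of_opNorm_le hop _).trans (by gcongr))
    have h2 : ‖L I c‖ ≤ ‖L I (‖x‖⁻¹ • x)‖ + ‖L I (‖x‖⁻¹ • x - c)‖ := by
      have : L I c = L I (‖x‖⁻¹ • x) - L I (‖x‖⁻¹ • x - c) := by rw [← map_sub]; congr 1; abel
      rw [this]
      exact norm_sub_le _ _
    have h3 := (hnet c hc).2
    have h4 : 1 / 200 ≤ ‖L I (‖x‖⁻¹ • x)‖ := by linarith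
    rw [map_smul, norm_smul, norm_inv, norm_norm, inv_mul_eq_div, le_div_iff₀ hx0] at h4
    exact h4
  rw [← hL]
  constructor
  · calc _ = (1 / 200 * ‖x‖) ^ 2 := by ring
      _ ≤ _ := by gcongr
  · calc _ ≤ (49 / 40 / (1 - 1 / 200) * ‖x‖) ^ 2 := by gcongr
      _ = (49 / 40 / (1 - 1 / 200)) ^ 2 * ‖x‖ ^ 2 := by ring
      _ ≤ _ := by gcongr; norm_num

/-- The number of supports of size at most `s`. -/
lemma card_supports_le {N k s : ℕ} (hk : 1 ≤ k) (hkN : k ≤ N) (hks : k ≤ s) :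
    ((Finset.univ.filter fun T : Finset (Fin N) => T.card ≤ s).card : ℝ) ≤
      Real.exp (s * Real.log (Real.exp 1 * N / k)) := by
  have hk0 : (0 : ℝ) < k := by exact_mod_cast hk
  have hN0 : (0 : ℝ) < N := by exact_mod_cast hk.trans hkN
  set y : ℝ := k / N with hy
  have hy0 : 0 < y := by positivity
  have hy1 : y ≤ 1 := (div_le_one hN0).2 (by exact_mod_cast hkN)
  -- In the binomial expansion of `(1 + y) ^ N` over subsets, each counted `T` has weight at least
  -- `y ^ s`, as `y ≤ 1`.
  have h1 : ((Finset.univ.filter fun T : Finset (Fin N) => T.card ≤ s).card : ℝ) * y ^ s ≤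
      (1 + y) ^ N := by
    have h2 := Finset.sum_pow_mul_eq_add_pow y 1 (Finset.univ : Finset (Fin N))
    simp only [one_pow, mul_one, Finset.powerset_univ, Finset.card_univ, Fintype.card_fin] at h2
    rw [add_comm, ← h2, ← nsmul_eq_mul]
    refine (Finset.card_nsmul_le_sum _ (fun T : Finset (Fin N) => y ^ T.card) _
      fun T hT => ?_).trans (Finset.sum_le_sum_of_subset_of_nonneg (Finset.subset_univ _)
        fun _ _ _ => by positivity)
    exact pow_le_pow_of_le_one hy0.le hy1 (by simpa using hT)
  have h3 : (1 + y) ^ N ≤ Real.exp s := by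
    calc (1 + y) ^ N ≤ Real.exp y ^ N := by
          gcongr
          rw [add_comm]; exact Real.add_one_le_exp y
      _ = Real.exp k := by
          rw [← Real.exp_nat_mul, hy]
          congr 1
          field_simp
      _ ≤ Real.exp s := Real.exp_le_exp.2 (by exact_mod_cast hks)
  have h4 : Real.exp (s * Real.log (Real.exp 1 * N / k)) = Real.exp s / y ^ s := by
    rw [Real.exp_nat_mul, Real.exp_log (by positivity), ← mul_one (s : ℝ), Real.exp_nat_mul 1 s,
      ← div_pow, hy]
    congr 1
    field_simp
  rw [h4, le_div_iff₀ (by positivity)]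
  exact h1.trans h3

/-- The span of the columns of `D` with index in `T`. -/
def columnSpan {n N : ℕ} (D : Matrix (Fin n) (Fin N) ℝ) (T : Finset (Fin N)) :
    Submodule ℝ (EuclideanSpace ℝ (Fin n)) :=
  Submodule.span ℝ (T.image fun i => WithLp.toLp 2 (D.col i) : Finset (EuclideanSpace ℝ (Fin n)))

lemma finrank_columnSpan_le {n N : ℕ} (D : Matrix (Fin n) (Fin N) ℝ) (T : Finset (Fin N)) :
    finrank ℝ (columnSpan D T) ≤ T.card :=
  (finrank_span_finset_le_card _).trans Finset.card_image_le

lemma toLp_mulVec_mem_columnSpan {n N : ℕ} (D : Matrix (Fin n) (Fin N) ℝ) {T : Finset (Fin N)}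
    {v : Fin N → ℝ} (hv : ∀ i, v i ≠ 0 → i ∈ T) : WithLp.toLp 2 (D *ᵥ v) ∈ columnSpan D T := by
  have h : WithLp.toLp 2 (D *ᵥ v) = ∑ i, v i • WithLp.toLp 2 (D.col i) := by
    ext j
    simp [Matrix.mulVec, dotProduct, mul_comm, Matrix.col]
  rw [h]
  refine Submodule.sum_mem _ fun i _ => ?_
  by_cases hi : v i = 0
  · simp [hi]
  · exact Submodule.smul_mem _ _ (Submodule.subset_span (by
      simpa using ⟨i, hv i hi, rfl⟩))

/-- The failure probability of the S-DRIP, from the union bound over supports and nets. -/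
lemma gaussianMatrixLaw_not_sdrip_le {m n N k s : ℕ} (hm : m ≠ 0) (D : Matrix (Fin n) (Fin N) ℝ)
    (hk : 1 ≤ k) (hkN : k ≤ N) (hks : k ≤ s) :
    gaussianMatrixLaw m n {A | ¬ SDRIP (Matrix.of A) D s (1 / 40000) (8 / 5)} ≤
      ENNReal.ofReal (Real.exp (s * Real.log (Real.exp 1 * N / k)) * 401 ^ s *
        (2 * Real.exp (-(m / 25)))) := by
  classical
  choose F hF1 hF2 hF3 using fun T : Finset (Fin N) =>
    exists_net_sphere (E := columnSpan D T) (ρ := 1 / 200) (by norm_num)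
  set S := Finset.univ.filter fun T : Finset (Fin N) => T.card ≤ s with hS
  have hcard : ∀ T ∈ S, ((F T).card : ℝ) ≤ 401 ^ s := by
    intro T hT
    refine (hF3 T).trans ?_
    norm_num
    exact pow_le_pow_right₀ (by norm_num) ((finrank_columnSpan_le D T).trans (by simpa [hS] using hT))
  have hsub : {A : Fin m → Fin n → ℝ | ¬ SDRIP (Matrix.of A) D s (1 / 40000) (8 / 5)} ⊆
      ⋃ T ∈ S, ⋃ c ∈ F T, distortingSet m (c : EuclideanSpace ℝ (Fin n)).ofLp := by
    intro A hA
    by_contra hcon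
    simp only [Set.mem_iUnion, not_exists] at hcon
    refine hA fun v hv I hI => ?_
    set T := Finset.univ.filter fun i => v i ≠ 0 with hT
    have hTS : T ∈ S := Finset.mem_filter.2 ⟨Finset.mem_univ _, hv⟩
    have hmem := toLp_mulVec_mem_columnSpan D (T := T) (v := v) (by simp [hT])
    have := energy_bounds_of_net (hF2 T) (fun c hc => hcon T hTS c hc) hI ⟨_, hmem⟩
    rw [l2norm_rowRestrict_mulVec_sq]
    exact this
  have hbad : ∀ T, ∀ c ∈ F T, gaussianMatrixLaw m n
      (distortingSet m (c : EuclideanSpace ℝ (Fin n)).ofLp) ≤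
        ENNReal.ofReal (2 * Real.exp (-(m / 25))) :=
    fun T c hc => gaussianMatrixLaw_distortingSet_le hm (hF1 T c hc)
  have hT : ∀ T ∈ S, gaussianMatrixLaw m n
      (⋃ c ∈ F T, distortingSet m (c : EuclideanSpace ℝ (Fin n)).ofLp) ≤
        ENNReal.ofReal (401 ^ s * (2 * Real.exp (-(m / 25)))) := by
    intro T hT
    refine (measure_biUnion_finset_le _ _).trans ((Finset.sum_le_sum (hbad T)).trans ?_)
    rw [Finset.sum_const, nsmul_eq_mul, ← ENNReal.ofReal_natCast,
      ← ENNReal.ofReal_mul (by positivity)]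
    exact ENNReal.ofReal_le_ofReal (mul_le_mul_of_nonneg_right (hcard T hT) (by positivity))
  refine (measure_mono hsub).trans ((measure_biUnion_finset_le _ _).trans
    ((Finset.sum_le_sum hT).trans ?_))
  rw [Finset.sum_const, nsmul_eq_mul, ← ENNReal.ofReal_natCast,
    ← ENNReal.ofReal_mul (by positivity), mul_assoc]
  exact ENNReal.ofReal_le_ofReal
    (mul_le_mul_of_nonneg_right (card_supports_le hk hkN hks) (by positivity))

lemma one_le_log_exp_one_mul_div {N k : ℕ} (hk : 1 ≤ k) (hkN : k ≤ N) :
    1 ≤ Real.log (Real.exp 1 * N / k) := by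
  have hk0 : (0 : ℝ) < k := by exact_mod_cast hk
  have hkN' : (k : ℝ) ≤ N := by exact_mod_cast hkN
  rw [Real.le_log_iff_exp_le (by have := hk0.trans_le hkN'; positivity), mul_div_assoc]
  exact le_mul_of_one_le_right (Real.exp_pos _).le ((one_le_div hk0).2 hkN')

/-- A Gaussian matrix satisfies the S-DRIP with overwhelming probability. -/
theorem gaussianMatrixLaw_not_sdrip_le_exp {m n N k : ℕ} {t : ℝ} (D : Matrix (Fin n) (Fin N) ℝ)
    (ht : 1 ≤ t) (hk : 1 ≤ k) (hkN : k ≤ N)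
    (hm : 1000 * (t * k * Real.log (Real.exp 1 * N / k)) ≤ m) :
    gaussianMatrixLaw m n {A | ¬ SDRIP (Matrix.of A) D ⌈t * k⌉₊ (1 / 40000) (8 / 5)} ≤
      ENNReal.ofReal (Real.exp (-(1 / 50 * m))) := by
  set l := Real.log (Real.exp 1 * N / k) with hl
  have hl1 : 1 ≤ l := one_le_log_exp_one_mul_div hk hkN
  have hk' : (1 : ℝ) ≤ k := by exact_mod_cast hk
  have htk : 1 ≤ t * k := one_le_mul_of_one_le_of_one_le ht hk'
  have htkl : 1 ≤ t * k * l := one_le_mul_of_one_le_of_one_le htk hl1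
  have hm0 : m ≠ 0 := by
    rintro rfl
    norm_num at hm
    linarith
  set s := ⌈t * k⌉₊ with hs
  have hs2 : (s : ℝ) ≤ 2 * (t * k) := by
    have := Nat.ceil_lt_add_one (by linarith : 0 ≤ t * k)
    linarith
  have hks : k ≤ s := by
    have : (k : ℝ) ≤ s := (le_mul_of_one_le_left (by linarith) ht).trans (Nat.le_ceil _)
    exact_mod_cast this
  refine (gaussianMatrixLaw_not_sdrip_le hm0 D hk hkN hks).trans (ENNReal.ofReal_le_ofReal ?_)
  rw [← hl]
  have h401 : (401 : ℝ) ≤ Real.exp 7 := by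
    have h1 := Real.exp_one_gt_d9
    have h2 : Real.exp 7 = Real.exp 1 ^ 7 := by rw [← Real.exp_nat_mul]; norm_num
    rw [h2]
    calc (401 : ℝ) ≤ 2.7 ^ 7 := by norm_num
      _ ≤ _ := by gcongr; linarith
  have h2 : (2 : ℝ) ≤ Real.exp 1 := by linarith [Real.exp_one_gt_d9]
  calc _ ≤ Real.exp (s * l) * Real.exp 7 ^ s * (Real.exp 1 * Real.exp (-(m / 25))) := by gcongr
    _ = Real.exp (s * l + s * 7 + (1 - m / 25)) := by
        rw [← Real.exp_nat_mul, ← Real.exp_add, ← Real.exp_add, ← Real.exp_add]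
        congr 1
    _ ≤ _ := by
        -- With `s ≤ 2 t k` and `l ≥ 1`, the positive terms are at most `17 t k l ≤ 17 m / 1000`,
        -- below `m / 25 - m / 50`.
        refine Real.exp_le_exp.2 ?_
        have h3 : (s : ℝ) * l ≤ 2 * (t * k) * l := by gcongr
        have h4 : (s : ℝ) * 1 ≤ s * l := by gcongr
        linarith

/-- The lower frame bound makes `Dᵀ` injective. This supplies `k ≤ N` in the bounded redundancy
case, where only `2 k ≤ n` is assumed. -/
lemma IsFrame.le_card {n N : ℕ} {D : Matrix (Fin n) (Fin N) ℝ} (hD : IsFrame D) : n ≤ N := by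
  obtain ⟨a, b, ha, -, h⟩ := hD
  have hinj : Function.Injective Dᵀ.mulVecLin := by
    rw [← LinearMap.ker_eq_bot, LinearMap.ker_eq_bot']
    intro x hx
    have h1 := (h x).1
    rw [Matrix.mulVecLin_apply] at hx
    rw [hx, l2norm_sq, l2norm_sq] at h1
    simp only [Pi.zero_apply] at h1
    have h2 : ∑ i, x i ^ 2 ≤ 0 := by
      by_contra hcon
      push Not at hcon
      have := mul_pos ha hcon
      norm_num at h1
      linarith
    have h3 := (Finset.sum_eq_zero_iff_of_nonneg fun i _ => sq_nonneg (x i)).1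
      (le_antisymm h2 (Finset.sum_nonneg fun i _ => sq_nonneg (x i)))
    ext i
    simpa using h3 i (Finset.mem_univ i)
  simpa using LinearMap.finrank_le_finrank_of_injective hinj

lemma IsTightFrame.isFrame {n N : ℕ} {D : Matrix (Fin n) (Fin N) ℝ} {a : ℝ}
    (hD : IsTightFrame D a) : IsFrame D :=
  ⟨a, a, hD.1, hD.1, fun x => ⟨(hD.2 x).ge, (hD.2 x).le⟩⟩

/-- For dictionaries of bounded redundancy `log (e N / k)` and `log (n / k)` are comparable. -/
lemma log_exp_one_mul_div_le {n N k : ℕ} {β : ℝ} (hβ : 1 ≤ β) (hN : (N : ℝ) ≤ β * n) (hk : 1 ≤ k)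
    (hkn : 2 * k ≤ n) (hkN : k ≤ N) :
    Real.log (Real.exp 1 * N / k) ≤
      (Real.log (Real.exp 1 * β) / Real.log 2 + 1) * Real.log (n / k) := by
  have hk0 : (0 : ℝ) < k := by exact_mod_cast hk
  have hN0 : (0 : ℝ) < N := hk0.trans_le (by exact_mod_cast hkN)
  have hn : 2 * (k : ℝ) ≤ n := by exact_mod_cast hkn
  have hn0 : (0 : ℝ) < n := by linarith
  have h2 : Real.log 2 ≤ Real.log (n / k) :=
    Real.log_le_log (by norm_num) ((le_div_iff₀ hk0).2 hn)
  have hl2 : 0 < Real.log 2 := Real.log_pos (by norm_num)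
  have he : 0 ≤ Real.log (Real.exp 1 * β) :=
    Real.log_nonneg (one_le_mul_of_one_le_of_one_le (Real.one_le_exp zero_le_one) hβ)
  calc Real.log (Real.exp 1 * N / k) ≤ Real.log (Real.exp 1 * β * (n / k)) := by
        refine Real.log_le_log (by positivity) ?_
        rw [mul_assoc, mul_div_assoc, ← mul_div_assoc β]
        gcongr
    _ = Real.log (Real.exp 1 * β) + Real.log (n / k) :=
        Real.log_mul (by positivity) (by positivity)
    _ ≤ Real.log (Real.exp 1 * β) / Real.log 2 * Real.log (n / k) + Real.log (n / k) := by
        gcongr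
        rw [div_mul_eq_mul_div, le_div_iff₀ hl2]
        gcongr
    _ = _ := by ring

/-- A Gaussian matrix allows stable phaseless recovery with overwhelming probability. -/
theorem gaussianMatrixLaw_not_stableRecovery_le_exp {m n N k t : ℕ} {a θm θp : ℝ}
    (hθm : θm = 1 / 40000) (hθp : θp = 8 / 5) {D : Matrix (Fin n) (Fin N) ℝ}
    (hD : IsTightFrame D a) (hk : 1 ≤ k) (hkN : k ≤ N)
    (ht : max (1 / (2 * θm - θm ^ 2)) (1 / (2 * θp - θp ^ 2)) < (t : ℝ))
    (hm : 1000 * (t * k * Real.log (Real.exp 1 * N / k)) ≤ m) :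
    gaussianMatrixLaw m n {A | ¬ StableRecovery (Matrix.of A) D k
        (noiseConst t (max (1 - θm) (θp - 1))) (approxConst t (max (1 - θm) (θp - 1)) / √a)} ≤
      ENNReal.ofReal (Real.exp (-(1 / 50 * m))) := by
  have ht1 : (1 : ℝ) < t := by
    refine lt_of_le_of_lt ?_ ((le_max_right _ _).trans_lt ht)
    rw [hθp]
    norm_num
  have ht2 : 2 ≤ t := by
    have : 1 < t := by exact_mod_cast ht1
    omega
  -- Since `2 θm - θm ^ 2 = 1 - (1 - θm) ^ 2` and the maximum is `1 - θm`, the hypothesis on `t`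
  -- says `δ ^ 2 < (t - 1) / t`.
  have hδt : max (1 - θm) (θp - 1) < √(((t : ℝ) - 1) / t) := by
    have h := (max_lt_iff.1 ht).1
    have hmax : max (1 - θm) (θp - 1) = 1 - θm := by rw [hθm, hθp]; norm_num
    have hpos : 0 < 2 * θm - θm ^ 2 := by rw [hθm]; norm_num
    rw [hmax]
    refine Real.lt_sqrt_of_sq_lt ?_
    rw [div_lt_iff₀ hpos] at h
    rw [lt_div_iff₀ (by linarith)]
    linarith
  have hδ : 0 ≤ max (1 - θm) (θp - 1) := by rw [hθm, hθp]; norm_num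
  refine (measure_mono ?_).trans
    (gaussianMatrixLaw_not_sdrip_le_exp (t := t) D ht1.le hk hkN hm)
  intro A hA hs
  refine hA (SDRIP.stableRecovery hD hk hkN ht2 hδ hδt ?_)
  rw [hθm, hθp]
  have e : ⌈(t : ℝ) * k⌉₊ = t * k := by rw [← Nat.cast_mul, Nat.ceil_natCast]
  rwa [e] at hs

end UnionBound

end PhaselessDictionary

theorem mainTheorem5 :
    ∃ θm θp c C : ℝ, 0 < θm ∧ θm < θp ∧ θp < 2 ∧ 0 < c ∧ 0 < C ∧
      -- S-DRIP of order `tk`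
      (∀ (m n N k : ℕ) (t : ℝ) (D : Matrix (Fin n) (Fin N) ℝ),
        IsFrame D → 1 ≤ t → 1 ≤ k → k ≤ N →
        C * (t * k * Real.log (Real.exp 1 * N / k)) ≤ m →
        gaussianMatrixLaw m n {A | ¬ SDRIP (Matrix.of A) D ⌈t * k⌉₊ θm θp} ≤
          ENNReal.ofReal (Real.exp (-(c * m)))) ∧
      -- stable recovery
      (∀ (m n N k t : ℕ) (a : ℝ) (D : Matrix (Fin n) (Fin N) ℝ),
        IsTightFrame D a → 1 ≤ k → k ≤ N →
        max (1 / (2 * θm - θm ^ 2)) (1 / (2 * θp - θp ^ 2)) < (t : ℝ) →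
        C * (t * k * Real.log (Real.exp 1 * N / k)) ≤ m →
        gaussianMatrixLaw m n {A | ¬ StableRecovery (Matrix.of A) D k
            (noiseConst t (max (1 - θm) (θp - 1)))
            (approxConst t (max (1 - θm) (θp - 1)) / √a)} ≤
          ENNReal.ofReal (Real.exp (-(c * m)))) ∧
      -- the same two facts with `log (n / k)`, for dictionaries of redundancy `N / n ≤ β`
      (∀ β : ℝ, 1 ≤ β → ∃ C' : ℝ, 0 < C' ∧
        (∀ (m n N k : ℕ) (t : ℝ) (D : Matrix (Fin n) (Fin N) ℝ),
          IsFrame D → (N : ℝ) ≤ β * n → 1 ≤ t → 1 ≤ k → 2 * k ≤ n →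
          C' * (t * k * Real.log (n / k)) ≤ m →
          gaussianMatrixLaw m n {A | ¬ SDRIP (Matrix.of A) D ⌈t * k⌉₊ θm θp} ≤
            ENNReal.ofReal (Real.exp (-(c * m)))) ∧
        (∀ (m n N k t : ℕ) (a : ℝ) (D : Matrix (Fin n) (Fin N) ℝ),
          IsTightFrame D a → (N : ℝ) ≤ β * n → 1 ≤ k → 2 * k ≤ n →
          max (1 / (2 * θm - θm ^ 2)) (1 / (2 * θp - θp ^ 2)) < (t : ℝ) →
          C' * (t * k * Real.log (n / k)) ≤ m →
          gaussianMatrixLaw m n {A | ¬ StableRecovery (Matrix.of A) D k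
              (noiseConst t (max (1 - θm) (θp - 1)))
              (approxConst t (max (1 - θm) (θp - 1)) / √a)} ≤
            ENNReal.ofReal (Real.exp (-(c * m))))) := by
  -- `1 / 40000 = (1 / 200) ^ 2` and `8 / 5` come from `energy_bounds_of_net`. The rate `1 / 50` is
  -- what remains of `1 / 25` after the union bound, for which `1000` is large enough.
  refine ⟨1 / 40000, 8 / 5, 1 / 50, 1000, by norm_num, by norm_num, by norm_num, by norm_num,
    by norm_num, ?_, ?_, ?_⟩
  · intro m n N k t D _ ht hk hkN hm
    exact gaussianMatrixLaw_not_sdrip_le_exp D ht hk hkN hm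
  · intro m n N k t a D hD hk hkN ht hm
    exact gaussianMatrixLaw_not_stableRecovery_le_exp rfl rfl hD hk hkN ht hm
  · intro β hβ
    have hlog : 0 ≤ Real.log (Real.exp 1 * β) / Real.log 2 :=
      div_nonneg (Real.log_nonneg
        (one_le_mul_of_one_le_of_one_le (Real.one_le_exp zero_le_one) hβ))
        (Real.log_nonneg (by norm_num))
    have hlogs : ∀ (m n N k : ℕ) (t : ℝ) (D : Matrix (Fin n) (Fin N) ℝ), IsFrame D →
        (N : ℝ) ≤ β * n → 0 ≤ t → 1 ≤ k → 2 * k ≤ n →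
        1000 * (Real.log (Real.exp 1 * β) / Real.log 2 + 1) * (t * k * Real.log (n / k)) ≤ m →
        k ≤ N ∧ 1000 * (t * k * Real.log (Real.exp 1 * N / k)) ≤ m := by
      intro m n N k t D hD hN ht hk hkn hm
      have hkN : k ≤ N := by have := hD.le_card; omega
      refine ⟨hkN, le_trans ?_ hm⟩
      have := mul_le_mul_of_nonneg_left (log_exp_one_mul_div_le hβ hN hk hkn hkN)
        (by positivity : 0 ≤ 1000 * (t * k))
      linarith
    refine ⟨1000 * (Real.log (Real.exp 1 * β) / Real.log 2 + 1), by positivity, ?_, ?_⟩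
    · intro m n N k t D hD hN ht hk hkn hm
      obtain ⟨hkN, hm'⟩ := hlogs m n N k t D hD hN (by linarith) hk hkn hm
      exact gaussianMatrixLaw_not_sdrip_le_exp D ht hk hkN hm'
    · intro m n N k t a D hD hN hk hkn ht hm
      obtain ⟨hkN, hm'⟩ := hlogs m n N k t D hD.isFrame hN (by positivity) hk hkn hm
      exact gaussianMatrixLaw_not_stableRecovery_le_exp rfl rfl hD hk hkN ht hm'
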